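/- All graphs are finite and simple. A graph is \emph{unicyclic} if it is connected and contains exactly one cycle $C$. A set $S\subseteq V(G)$ is \emph{resolving} if for any two distinct vertices $u,v$ there is $x\in S$ with $d(u,x)\neq d(v,x)$; a \emph{metric basis} is a resolving set of smallest cardinality; a vertex is \emph{basis forced} if it belongs to every metric basis. For a unicyclic graph $G$ and $v\in V(C)$, let $T_v$ be the component of $G-E(C)$ containing $v$. A vertex is \emph{branching} if it lies on $C$ and has degree at least $4$, or does not lie on $C$ and has degree at least $3$. A vertex $v$ of $C$ is \emph{branch-active} if $T_v$ contains a branching vertex, and $b(G)$ denotes the number of branch-active vertices of $C$. (a) If $G$ is a unicyclic graph with girth at least $4$ that contains exactly one basis forced vertex, then $b(G)\le 1$. (b) Every unicyclic graph $G$ with at least one basis forced vertex is of one of the following three (mutually exclusive) types: \begin{itemize} \item[(I)] $b(G)=0$, and $G$ has exactly two basis forced vertices and a unique metric basis; \item[(II)] $b(G)=0$, and $G$ has exactly one basis forced vertex; \item[(III)] $b(G)=1$, and $G$ has exactly one basis forced vertex. \end{itemize} (c) Each of the three types is realized by some unicyclic graph of girth at least $4$. -/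

import Mathlib

namespace Unicyclic

/-- The set `S` is resolving: any two distinct vertices have different distances to some
vertex of `S`. -/
def IsResolving {V : Type*} (G : SimpleGraph V) (S : Finset V) : Prop :=
  ∀ u v : V, u ≠ v → ∃ x ∈ S, G.dist u x ≠ G.dist v x

/-- A metric basis is a resolving set of smallest possible cardinality. -/
def IsMetricBasis {V : Type*} (G : SimpleGraph V) (S : Finset V) : Prop :=
  IsResolving G S ∧ ∀ T : Finset V, IsResolving G T → S.card ≤ T.card

/-- The set of basis forced vertices: the vertices that belong to every metric basis. -/
def basisForced {V : Type*} (G : SimpleGraph V) : Set V :=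
  {v | ∀ S : Finset V, IsMetricBasis G S → v ∈ S}

/-- A unicyclic graph is a connected graph that contains exactly one cycle. A cycle is
identified with its set of edges, so that the starting point and the orientation of the closed
walk do not matter. -/
def IsUnicyclic {V : Type*} (G : SimpleGraph V) : Prop :=
  G.Connected ∧
    ∃! E : Set (Sym2 V), ∃ (v : V) (c : G.Walk v v), c.IsCycle ∧ {e | e ∈ c.edges} = E

/-- The vertices that lie on a cycle; in a unicyclic graph this is `V(C)`. -/
def cycleVerts {V : Type*} (G : SimpleGraph V) : Set V :=
  {v | ∃ (u : V) (c : G.Walk u u), c.IsCycle ∧ v ∈ c.support}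

/-- The edges that lie on a cycle; in a unicyclic graph this is `E(C)`. -/
def cycleEdges {V : Type*} (G : SimpleGraph V) : Set (Sym2 V) :=
  {e | ∃ (u : V) (c : G.Walk u u), c.IsCycle ∧ e ∈ c.edges}

/-- The vertex set of the component `T_v` of `G - E(C)` that contains `v`. -/
def treeAt {V : Type*} (G : SimpleGraph V) (v : V) : Set V :=
  {u | (G.deleteEdges (cycleEdges G)).Reachable v u}

/-- A branching vertex: a vertex of degree at least 4 on the cycle, or a vertex of degree at
least 3 that is not on the cycle. -/
def IsBranching {V : Type*} (G : SimpleGraph V) (v : V) : Prop :=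
  (v ∈ cycleVerts G ∧ 4 ≤ (G.neighborSet v).ncard) ∨
    (v ∉ cycleVerts G ∧ 3 ≤ (G.neighborSet v).ncard)

/-- A branch-active vertex: a vertex `v` of the cycle such that `T_v` contains a branching
vertex. -/
def IsBranchActive {V : Type*} (G : SimpleGraph V) (v : V) : Prop :=
  v ∈ cycleVerts G ∧ ∃ u ∈ treeAt G v, IsBranching G u

/-- The number `b(G)` of branch-active vertices on the cycle. -/
noncomputable def b {V : Type*} (G : SimpleGraph V) : ℕ :=
  {v | IsBranchActive G v}.ncard

/-- First type: no branch-active vertex, two basis forced vertices, a unique metric basis. -/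
def IsTypeI {V : Type*} (G : SimpleGraph V) : Prop :=
  b G = 0 ∧ (basisForced G).ncard = 2 ∧ ∃! S : Finset V, IsMetricBasis G S

/-- Second type: no branch-active vertex, exactly one basis forced vertex. -/
def IsTypeII {V : Type*} (G : SimpleGraph V) : Prop :=
  b G = 0 ∧ (basisForced G).ncard = 1

/-- Third type: one branch-active vertex, exactly one basis forced vertex. -/
def IsTypeIII {V : Type*} (G : SimpleGraph V) : Prop :=
  b G = 1 ∧ (basisForced G).ncard = 1

end Unicyclic

/-! Let `S` be a metric basis, `x` a basis forced vertex and `R = S \ {x}`. A set that avoids `x`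
and has at most `|S|` vertices cannot be resolving, since it would be a metric basis without `x`. So
`R` is not resolving, nor is `R` together with any `y ≠ x`. Everything follows from these failed
exchanges.

First, `R` alone resolves any two vertices of the same tree at equal depth, where depth is the
distance to the cycle (`Coords.exists_dist_ne_of_forced`). If only `x` resolved them, `x` would be
off the cycle in their tree. The bridge exchanges then make `x` a leaf at a cycle vertex `v`, and no
other tree neighbour of `v` looks the same from `R`; this rules the pair out.

Second, `R` lies in one tree (`Coords.idx_eq_of_forced`). A distance between different trees is
depth + cycle distance + depth. Hence two vertices of different trees that look the same from `R`
have the same difference of cycle distances to every root of a tree met by `R`. If `R` met two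
trees, their roots could be completed to a doubly resolving set of the cycle by a third vertex
(`exists_doubly_resolving`). There is always a choice other than the root of the tree of `x`, so
that vertex could replace `x`.

Third, a branch-active vertex has two vertices of equal depth in its tree, so `R` meets that tree.
Thus at most one vertex is branch-active. If `x` and `y` are both forced, then `S \ {x}` and `S \
{y}` each lie in one tree while `S` does not. This forces `S = {x, y}` with `x`, `y` in different
trees, and a branch-active vertex would have to be the root of both.

The examples are hexagons with small trees attached, checked from explicit distance tables. -/

namespace Unicyclic

/-! ### Distances and doubly resolving sets on a cycle -/

/-- The distance of the vertices `a, b < g` in the cycle graph on `0, …, g - 1`. -/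
def cyc (g a b : ℕ) : ℕ := min (a - b + (b - a)) (g - (a - b + (b - a)))

theorem cyc_comm (g a b : ℕ) : cyc g a b = cyc g b a := by
  unfold cyc; congr 1 <;> omega

theorem cyc_triangle {g a b c : ℕ} (ha : a < g) (hb : b < g) (hc : c < g) :
    cyc g a c ≤ cyc g a b + cyc g b c := by
  unfold cyc; omega

theorem cyc_pos {g a b : ℕ} (ha : a < g) (hb : b < g) (h : a ≠ b) : 0 < cyc g a b := by
  unfold cyc; omega

theorem cyc_self (g a : ℕ) : cyc g a a = 0 := by
  unfold cyc; omega

/-- The vertices `0`, `q` and their antipodes cut the cycle into four arcs on which both distances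
are affine. Along them the difference of the distances to `0` and `q` is `2i - q`, `q`, `g + q -
2i`, `-q`, so the two constant arcs are what a third vertex must separate. -/
theorem cyc_zero_and_cyc {g q i : ℕ} (hi : i < g) (hqg : 2 * q ≤ g) :
    (i ≤ q ∧ cyc g i 0 = i ∧ cyc g i q = q - i) ∨
    (q < i ∧ 2 * i ≤ g ∧ cyc g i 0 = i ∧ cyc g i q = i - q) ∨
    (q < i ∧ g < 2 * i ∧ 2 * i ≤ 2 * q + g ∧ cyc g i 0 = g - i ∧ cyc g i q = i - q) ∨
    (2 * q + g < 2 * i ∧ cyc g i 0 = g - i ∧ cyc g i q = g + q - i) := by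
  unfold cyc; omega

theorem cyc_half {g i : ℕ} (hi : i < g) :
    (i ≤ g / 2 ∧ cyc g i (g / 2) = g / 2 - i) ∨ (g / 2 < i ∧ cyc g i (g / 2) = i - g / 2) := by
  unfold cyc; omega

theorem cyc_cases (g i c : ℕ) :
    (i ≤ c ∧ 2 * (c - i) ≤ g ∧ cyc g i c = c - i) ∨
    (i ≤ c ∧ g < 2 * (c - i) ∧ cyc g i c = g - (c - i)) ∨
    (c < i ∧ 2 * (i - c) ≤ g ∧ cyc g i c = i - c) ∨
    (c < i ∧ g < 2 * (i - c) ∧ cyc g i c = g - (i - c)) := by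
  unfold cyc; omega

/-- Antipodal vertices have constant distance sum, so `h1` gives equal distances to `0`, hence `j =
i` or `j` is the mirror image of `i`. The vertex `c` is off the mirror axis and excludes the latter.
-/
theorem eq_of_cyc_antipodal {g q c i j : ℕ} (hqg : 2 * q = g)
    (hc : c < g) (hc0 : c ≠ 0) (hcq : c ≠ q) (hi : i < g) (hj : j < g)
    (h1 : (cyc g i 0 : ℤ) - cyc g j 0 = cyc g i q - cyc g j q)
    (h2 : (cyc g i 0 : ℤ) - cyc g j 0 = cyc g i c - cyc g j c) : i = j := by
  have h0 : cyc g i 0 = cyc g j 0 := by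
    rcases cyc_zero_and_cyc hi hqg.le with h | h | h | h <;>
    rcases cyc_zero_and_cyc hj hqg.le with h' | h' | h' | h' <;> omega
  have h3 : cyc g i c = cyc g j c := by omega
  have e : i = j ∨ i + j = g := by
    rcases cyc_zero_and_cyc hi hqg.le with h | h | h | h <;>
    rcases cyc_zero_and_cyc hj hqg.le with h' | h' | h' | h' <;> omega
  rcases e with e | e
  · exact e
  · rcases cyc_cases g i c with h | h | h | h <;>
    rcases cyc_cases g j c with h' | h' | h' | h' <;> omega

theorem eq_of_cyc_half {g q i j : ℕ} (hq : 0 < q) (hqg : 2 * q < g) (hi : i < g) (hj : j < g)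
    (h1 : (cyc g i 0 : ℤ) - cyc g j 0 = cyc g i q - cyc g j q)
    (h2 : (cyc g i 0 : ℤ) - cyc g j 0 = cyc g i (g / 2) - cyc g j (g / 2)) : i = j := by
  rcases cyc_zero_and_cyc hi hqg.le with h | h | h | h <;>
  rcases cyc_zero_and_cyc hj hqg.le with h' | h' | h' | h' <;>
  rcases cyc_half hi with k | k <;>
  rcases cyc_half hj with k' | k' <;> omega

theorem eq_of_cyc_half_add {g q i j : ℕ} (hq : 0 < q) (hqg : 2 * q < g) (hi : i < g) (hj : j < g)
    (hc : q + (g + 1) / 2 < g)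
    (h1 : (cyc g i 0 : ℤ) - cyc g j 0 = cyc g i q - cyc g j q)
    (h2 : (cyc g i 0 : ℤ) - cyc g j 0 =
      cyc g i (q + (g + 1) / 2) - cyc g j (q + (g + 1) / 2)) : i = j := by
  rcases cyc_zero_and_cyc hi hqg.le with h | h | h | h <;>
  rcases cyc_zero_and_cyc hj hqg.le with h' | h' | h' | h' <;>
  rcases cyc_cases g i (q + (g + 1) / 2) with k | k | k | k <;>
  first
  | omega
  | (rcases cyc_cases g j (q + (g + 1) / 2) with k' | k' | k' | k' <;> omega)

/-- The bounds force `g = 2q + 1`. The two constant arcs are then empty, and the values on the other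
two arcs have different parity. -/
theorem eq_of_cyc_near_antipodal {g q i j : ℕ} (hqg : 2 * q < g) (hi : i < g) (hj : j < g)
    (hc : g ≤ q + (g + 1) / 2)
    (h1 : (cyc g i 0 : ℤ) - cyc g j 0 = cyc g i q - cyc g j q) : i = j := by
  rcases cyc_zero_and_cyc hi hqg.le with h | h | h | h <;>
  rcases cyc_zero_and_cyc hj hqg.le with h' | h' | h' | h' <;> omega

/-- Adding one of two suitable vertices `c` to `0, q` gives a doubly resolving set of the cycle. -/
theorem exists_doubly_resolving_zero {g q : ℕ} (hg : 3 ≤ g) (hq : 0 < q) (hqg : 2 * q ≤ g)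
    (x : ℕ) :
    ∃ c < g, c ≠ x ∧ ∀ i < g, ∀ j < g,
      (cyc g i 0 : ℤ) - cyc g j 0 = cyc g i q - cyc g j q →
      (cyc g i 0 : ℤ) - cyc g j 0 = cyc g i c - cyc g j c → i = j := by
  rcases hqg.eq_or_lt with h2 | h2
  · obtain ⟨c, hc, hc0, hcq, hcx⟩ : ∃ c < g, c ≠ 0 ∧ c ≠ q ∧ c ≠ x := by
      by_cases hx : x = 1
      · exact ⟨q + 1, by omega, by omega, by omega, by omega⟩
      · exact ⟨1, by omega, by omega, by omega, by omega⟩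
    exact ⟨c, hc, hcx, fun i hi j hj => eq_of_cyc_antipodal h2 hc hc0 hcq hi hj⟩
  · by_cases hx : x = g / 2
    · by_cases hc : q + (g + 1) / 2 < g
      -- This is the image of `g / 2` under the reflection that swaps `0` and `q`.
      · exact ⟨q + (g + 1) / 2, hc, by omega, fun i hi j hj =>
          eq_of_cyc_half_add hq h2 hi hj hc⟩
      -- Here `0` and `q` already suffice; `0` is a filler different from `x = g / 2`.
      · exact ⟨0, by omega, by omega, fun i hi j hj h _ =>
          eq_of_cyc_near_antipodal h2 hi hj (by omega) h⟩
    · exact ⟨g / 2, by omega, fun h => hx h.symm, fun i hi j hj => eq_of_cyc_half hq h2 hi hj⟩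

/-- Rotation of the labels `0, …, g - 1` by `s`. -/
def rot (g s a : ℕ) : ℕ := if a + s < g then a + s else a + s - g

theorem rot_lt {g s a : ℕ} (hs : s ≤ g) (ha : a < g) : rot g s a < g := by
  unfold rot; split <;> omega

theorem rot_rot {g s t a : ℕ} (hs : s + t = g) (ha : a < g) : rot g t (rot g s a) = a := by
  unfold rot; split <;> split <;> omega

theorem cyc_rot {g s a c : ℕ} (hs : s ≤ g) (ha : a < g) (hc : c < g) :
    cyc g (rot g s a) (rot g s c) = cyc g a c := by
  unfold rot cyc; split <;> split <;> omega

theorem exists_doubly_resolving_of_le {g p q k : ℕ} (hg : 3 ≤ g) (hp : p < g)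
    (hk : 0 < k) (hkg : 2 * k ≤ g) (hq : q = rot g p k) (x : ℕ) :
    ∃ c < g, c ≠ x ∧ ∀ i < g, ∀ j < g,
      (cyc g i p : ℤ) - cyc g j p = cyc g i q - cyc g j q →
      (cyc g i p : ℤ) - cyc g j p = cyc g i c - cyc g j c → i = j := by
  obtain ⟨t, ht⟩ := Nat.exists_eq_add_of_le hp.le
  obtain ⟨c, hc, hcx, h⟩ := exists_doubly_resolving_zero hg hk hkg (rot g t x)
  refine ⟨rot g p c, rot_lt hp.le hc, ?_, fun i hi j hj h1 h2 => ?_⟩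
  · rintro rfl
    exact hcx (rot_rot ht.symm hc).symm
  · have hp0 : p = rot g p 0 := by unfold rot; split <;> omega
    have key : ∀ a < g, ∀ d < g, cyc g a (rot g p d) = cyc g (rot g t a) d := by
      intro a ha d hd
      rw [← cyc_rot (s := p) hp.le (rot_lt (by omega) ha) hd, rot_rot (by omega) ha]
    have hkg' : k < g := by omega
    have h0g : 0 < g := by omega
    have := h (rot g t i) (rot_lt (by omega) hi) (rot g t j) (rot_lt (by omega) hj)
      (by
        rw [← key i hi 0 h0g, ← key j hj 0 h0g, ← key i hi k hkg', ← key j hj k hkg', ← hp0, ← hq]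
        exact h1)
      (by
        rw [← key i hi 0 h0g, ← key j hj 0 h0g, ← key i hi c hc, ← key j hj c hc, ← hp0]
        exact h2)
    rw [← rot_rot (s := t) (t := p) (by omega) hi, this, rot_rot (by omega) hj]

/-- For two vertices `p, q` of a cycle there are at least two vertices `c` such that `p, q, c`
form a doubly resolving set. -/
theorem exists_doubly_resolving {g p q : ℕ} (hg : 3 ≤ g) (hp : p < g) (hq : q < g)
    (hpq : p ≠ q) (x : ℕ) :
    ∃ c < g, c ≠ x ∧ ∀ i < g, ∀ j < g,
      (cyc g i p : ℤ) - cyc g j p = cyc g i q - cyc g j q →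
      (cyc g i p : ℤ) - cyc g j p = cyc g i c - cyc g j c → i = j := by
  by_cases h : ∃ k, 0 < k ∧ 2 * k ≤ g ∧ q = rot g p k
  · obtain ⟨k, hk, hkg, hqk⟩ := h
    exact exists_doubly_resolving_of_le hg hp hk hkg hqk x
  -- One of the two arcs between `p` and `q` has length at most `g / 2`; if it does not start at
  -- `p`, it starts at `q`.
  · obtain ⟨k, hk, hkg, hpk⟩ : ∃ k, 0 < k ∧ 2 * k ≤ g ∧ p = rot g q k := by
      by_contra h'
      push Not at h h'
      have a1 := h (q - p)
      have a2 := h (q + g - p)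
      have b1 := h' (p - q)
      have b2 := h' (p + g - q)
      unfold rot at a1 a2 b1 b2
      rcases Nat.lt_or_gt_of_ne hpq with hl | hl
      · rw [if_pos (by omega)] at a1
        rw [if_neg (by omega)] at b2
        omega
      · rw [if_pos (by omega)] at b1
        rw [if_neg (by omega)] at a2
        omega
    obtain ⟨c, hc, hcx, h⟩ := exists_doubly_resolving_of_le hg hq hk hkg hpk x
    exact ⟨c, hc, hcx, fun i hi j hj h1 h2 => h i hi j hj h1.symm (by rw [← h1]; exact h2)⟩


open SimpleGraph

/-! ### Distances across a bridge -/

section Bridge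

variable {V : Type*} {G : SimpleGraph V}

theorem exists_adj_dist_eq_add_one (hG : G.Connected) {a x : V} (h : a ≠ x) :
    ∃ z, G.Adj x z ∧ G.dist a x = G.dist a z + 1 := by
  obtain ⟨p, hp⟩ := hG.exists_walk_length_eq_dist x a
  cases p with
  | nil => exact absurd rfl h
  | @cons _ z _ hz p =>
    refine ⟨z, hz, ?_⟩
    have h1 := dist_le p
    have h2 := hG.dist_triangle (u := x) (v := z) (w := a)
    rw [Walk.length_cons] at hp
    rw [dist_eq_one_iff_adj.2 hz] at h2
    rw [dist_comm (u := a) (v := x), dist_comm (u := a) (v := z)]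
    omega

theorem dist_eq_add_one_of_leaf (hG : G.Connected) {a x v : V} (hx : ∀ z, G.Adj x z → z = v)
    (h : a ≠ x) : G.dist a x = G.dist a v + 1 := by
  obtain ⟨z, hz, hd⟩ := exists_adj_dist_eq_add_one hG h
  rwa [hx z hz] at hd

theorem reachable_delete_or (hG : G.Connected) (x y a : V) :
    (G.deleteEdges {s(x, y)}).Reachable a x ∨ (G.deleteEdges {s(x, y)}).Reachable a y := by
  obtain ⟨p⟩ := hG.preconnected a x
  suffices h : ∀ {z : V} (_ : G.Walk a z), z = x →
      (G.deleteEdges {s(x, y)}).Reachable a x ∨ (G.deleteEdges {s(x, y)}).Reachable a y from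
    h p rfl
  clear p
  intro z p hz
  induction p with
  | nil => subst hz; exact Or.inl .rfl
  | @cons a b c hab p ih =>
    by_cases he : s(a, b) = s(x, y)
    · rcases Sym2.eq_iff.1 he with ⟨rfl, rfl⟩ | ⟨rfl, rfl⟩
      · exact Or.inl .rfl
      · exact Or.inr .rfl
    · have : (G.deleteEdges {s(x, y)}).Adj a b := by
        rw [deleteEdges_adj]; exact ⟨hab, he⟩
      exact (ih hz).imp this.reachable.trans this.reachable.trans

theorem dist_add_one_add_dist_le_length (hG : G.Connected) {x y a c : V}
    (hb : G.IsBridge s(x, y)) (p : G.Walk a c)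
    (ha : (G.deleteEdges {s(x, y)}).Reachable a x)
    (hc : (G.deleteEdges {s(x, y)}).Reachable c y) :
    G.dist a x + 1 + G.dist y c ≤ p.length := by
  rw [isBridge_iff] at hb
  induction p with
  | nil => exact absurd (ha.symm.trans hc) hb
  | @cons a b c hab p ih =>
    rw [Walk.length_cons]
    by_cases he : s(a, b) = s(x, y)
    · rcases Sym2.eq_iff.1 he with ⟨rfl, rfl⟩ | ⟨rfl, rfl⟩
      · have := dist_le p
        rw [dist_self]; omega
      · exact absurd ha.symm hb
    · have hab' : (G.deleteEdges {s(x, y)}).Adj b a := by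
        rw [deleteEdges_adj]; exact ⟨hab.symm, fun h => he (Sym2.eq_swap.trans h)⟩
      have := ih (hab'.reachable.trans ha) hc
      have h2 := hG.dist_triangle (u := a) (v := b) (w := x)
      rw [dist_eq_one_iff_adj.2 hab] at h2
      omega

theorem dist_eq_of_reachable_delete (hG : G.Connected) {x y a c : V} (hxy : G.Adj x y)
    (hb : G.IsBridge s(x, y))
    (ha : (G.deleteEdges {s(x, y)}).Reachable a x)
    (hc : (G.deleteEdges {s(x, y)}).Reachable c y) :
    G.dist a c = G.dist a x + 1 + G.dist c y := by
  obtain ⟨p, hp⟩ := hG.exists_walk_length_eq_dist a c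
  have h1 := dist_add_one_add_dist_le_length hG hb p ha hc
  have h2 := hG.dist_triangle (u := a) (v := x) (w := c)
  have h3 := hG.dist_triangle (u := x) (v := y) (w := c)
  rw [dist_eq_one_iff_adj.2 hxy] at h3
  rw [dist_comm (u := c)]
  omega

/-- The two alternatives say on which side of the bridge `a` lies. From here on, sides are expressed
by these distance equations instead of reachability. -/
theorem bridge_cases (hG : G.Connected) {x y : V} (hxy : G.Adj x y) (hb : G.IsBridge s(x, y))
    (a : V) : G.dist a y = G.dist a x + 1 ∨ G.dist a x = G.dist a y + 1 := by
  rcases reachable_delete_or hG x y a with h | h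
  · left
    simpa using dist_eq_of_reachable_delete hG hxy hb h .rfl
  · right
    have := dist_eq_of_reachable_delete hG hxy hb .rfl h
    rw [dist_self, dist_comm] at this
    omega

/-- The distance between vertices on different sides of a bridge. -/
theorem bridge_dist (hG : G.Connected) {x y a c : V} (hxy : G.Adj x y) (hb : G.IsBridge s(x, y))
    (ha : G.dist a y = G.dist a x + 1) (hc : G.dist c x = G.dist c y + 1) :
    G.dist a c = G.dist a x + 1 + G.dist c y := by
  refine dist_eq_of_reachable_delete hG hxy hb ?_ ?_
  · refine (reachable_delete_or hG x y a).resolve_right fun h => ?_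
    have := dist_eq_of_reachable_delete hG hxy hb .rfl h
    rw [dist_self, dist_comm] at this
    omega
  · refine (reachable_delete_or hG x y c).resolve_left fun h => ?_
    have := dist_eq_of_reachable_delete hG hxy hb h .rfl
    rw [dist_self] at this
    omega

/-- Since `y` is on the `x` side of the bridge `xz`, a vertex `a` on the `z` side would be reached
from `y` only through `x`, so `a` could not be nearer to `y` than to `x`. -/
theorem bridge_unique (hG : G.Connected) {x y z a : V} (hxy : G.Adj x y) (hxz : G.Adj x z)
    (hb : G.IsBridge s(x, z)) (hyz : y ≠ z) (ha : G.dist a x = G.dist a y + 1) :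
    G.dist a z = G.dist a x + 1 := by
  refine (bridge_cases hG hxz hb a).resolve_right fun h => ?_
  have h1 : G.dist y x = 1 := dist_eq_one_iff_adj.2 hxy.symm
  have h2 : 0 < G.dist y z := hG.pos_dist_of_ne hyz
  have h3 := bridge_cases hG hxz hb y
  have h4 := bridge_dist hG hxz hb (a := y) (c := a) (by omega) h
  rw [dist_comm (u := y) (v := a)] at h4
  omega

end Bridge

/-! ### Exchanging a basis forced vertex -/

section Exchange

variable {V : Type*} {G : SimpleGraph V} {S : Finset V} {x : V}

theorem not_isResolving_of_forced (hx : x ∈ basisForced G) (hS : IsMetricBasis G S)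
    {T : Finset V} (hT : T.card ≤ S.card) (hxT : x ∉ T) : ¬ IsResolving G T :=
  fun h => hxT (hx T ⟨h, fun U hU => hT.trans (hS.2 U hU)⟩)

variable [DecidableEq V]

theorem not_isResolving_insert_of_forced (hx : x ∈ basisForced G) (hS : IsMetricBasis G S)
    {y : V} (hy : y ≠ x) : ¬ IsResolving G (insert y (S.erase x)) := by
  refine not_isResolving_of_forced hx hS ?_ (by simp [hy.symm])
  have h1 := Finset.card_insert_le y (S.erase x)
  have h2 := Finset.card_erase_add_one (hx S hS)
  omega

theorem not_isResolving_erase_of_forced (hx : x ∈ basisForced G) (hS : IsMetricBasis G S) :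
    ¬ IsResolving G (S.erase x) :=
  not_isResolving_of_forced hx hS (Finset.card_le_card (Finset.erase_subset _ _)) (by simp)

/-- A pair that is unresolved by `S \ {x}` is resolved by `x`. -/
theorem dist_ne_of_erase (hS : IsResolving G S) {u w : V} (huw : u ≠ w)
    (h : ∀ s ∈ S.erase x, G.dist u s = G.dist w s) : G.dist u x ≠ G.dist w x := by
  obtain ⟨s, hs, hd⟩ := hS u w huw
  by_cases hsx : s = x
  · rwa [← hsx]
  · exact absurd (h s (Finset.mem_erase.2 ⟨hsx, hs⟩)) hd

/-- A resolving set stays resolving when a vertex is removed that separates it. -/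
theorem isResolving_erase_of_separating (hG : G.Connected) (hS : IsResolving G S) {y s t : V}
    (hxy : G.Adj x y) (hb : G.IsBridge s(x, y)) (hs : s ∈ S.erase x) (ht : t ∈ S.erase x)
    (hsy : G.dist s x = G.dist s y + 1) (hty : G.dist t y = G.dist t x + 1) :
    IsResolving G (S.erase x) := by
  intro u w huw
  by_contra! h
  have hne := dist_ne_of_erase hS huw h
  -- For vertices on opposite sides, `s` shows that the one beyond `y` is strictly farther from the
  -- bridge than the other, and `t` shows the reverse.
  have key : ∀ u w : V, (∀ s ∈ S.erase x, G.dist u s = G.dist w s) →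
      G.dist u x = G.dist u y + 1 → G.dist w y = G.dist w x + 1 → False := by
    intro a b h ha hb'
    have e1 := bridge_dist hG hxy hb hb' hsy
    have e2 := bridge_dist hG hxy hb hty ha
    have e3 := h s hs
    have e4 := h t ht
    have e5 := hG.dist_triangle (u := a) (v := y) (w := s)
    have e6 := hG.dist_triangle (u := b) (v := x) (w := t)
    rw [dist_comm (u := y)] at e5
    rw [dist_comm (u := x)] at e6
    rw [dist_comm (u := t)] at e2
    omega
  rcases bridge_cases hG hxy hb u with hu | hu <;> rcases bridge_cases hG hxy hb w with hw | hw
  · have e1 := bridge_dist hG hxy hb hu hsy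
    have e2 := bridge_dist hG hxy hb hw hsy
    have e3 := h s hs
    omega
  · exact key w u (fun s hs => (h s hs).symm) hw hu
  · exact key u w h hu hw
  · have e1 := bridge_dist hG hxy hb hty hu
    have e2 := bridge_dist hG hxy hb hty hw
    have e3 := h t ht
    rw [dist_comm (u := t)] at e1 e2
    omega

/-- Moving a vertex of a resolving set along a bridge away from all the other ones. -/
theorem isResolving_insert_of_bridge (hG : G.Connected) (hS : IsResolving G S) {z t : V}
    (hxz : G.Adj x z) (hb : G.IsBridge s(x, z)) (ht : t ∈ S.erase x)
    (hz : ∀ s ∈ S.erase x, G.dist s z = G.dist s x + 1) :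
    IsResolving G (insert z (S.erase x)) := by
  intro u w huw
  by_contra! h
  have h0 := h z (Finset.mem_insert_self _ _)
  have h1 : ∀ s ∈ S.erase x, G.dist u s = G.dist w s :=
    fun s hs => h s (Finset.mem_insert_of_mem hs)
  have hne := dist_ne_of_erase hS huw h1
  -- Across the bridge, equal distance to `z` puts `w` nearer to `x` than `u` is to `z`, so `w` is
  -- strictly nearer to `t`.
  have key : ∀ u w : V, G.dist u z = G.dist w z → G.dist u t = G.dist w t →
      G.dist u x = G.dist u z + 1 → G.dist w z = G.dist w x + 1 → False := by
    intro a b h0 h1 ha hb'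
    have e2 := bridge_dist hG hxz hb (hz t ht) ha
    have e6 := hG.dist_triangle (u := b) (v := x) (w := t)
    rw [dist_comm (u := x)] at e6
    rw [dist_comm (u := t)] at e2
    omega
  rcases bridge_cases hG hxz hb u with hu | hu <;> rcases bridge_cases hG hxz hb w with hw | hw
  · omega
  · exact key w u h0.symm (h1 t ht).symm hw hu
  · exact key u w h0 (h1 t ht) hu hw
  · omega

/-- A basis forced vertex all of whose edges are bridges is a leaf. -/
theorem exists_unique_adj_of_forced (hG : G.Connected) (hx : x ∈ basisForced G)
    (hS : IsMetricBasis G S) (hne : (S.erase x).Nonempty)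
    (hb : ∀ y, G.Adj x y → G.IsBridge s(x, y)) :
    ∃ v, G.Adj x v ∧ ∀ z, G.Adj x z → z = v := by
  obtain ⟨s, hs⟩ := hne
  obtain ⟨y, hxy, hsy⟩ := exists_adj_dist_eq_add_one hG (Finset.ne_of_mem_erase hs)
  refine ⟨y, hxy, fun z hxz => ?_⟩
  by_contra hzy
  -- With remaining vertices on both sides of `xy`, the vertex `x` would be superfluous; so all of
  -- them lie behind `y`.
  have hall : ∀ t ∈ S.erase x, G.dist t x = G.dist t y + 1 := fun t ht =>
    (bridge_cases hG hxy (hb y hxy) t).resolve_left fun h =>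
      not_isResolving_erase_of_forced hx hS
        (isResolving_erase_of_separating hG hS.1 hxy (hb y hxy) hs ht hsy h)
  -- A second neighbour `z` then points away from all of them, and `x` could be moved to `z`.
  exact not_isResolving_insert_of_forced hx hS hxz.ne'
    (isResolving_insert_of_bridge hG hS.1 hxz (hb z hxz) hs fun t ht =>
      bridge_unique hG hxy hxz (hb z hxz) (Ne.symm hzy) (hall t ht))

/-- Exchanging a leaf `x` at `v` for another neighbour `w` of `v` that is not distinguished
from `x` by the rest of the resolving set. -/
theorem isResolving_insert_of_twin (hG : G.Connected) (hS : IsResolving G S) {v w t : V}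
    (hxv : G.Adj x v) (hx : ∀ z, G.Adj x z → z = v) (hvw : G.Adj v w) (hwx : w ≠ x)
    (hb : G.IsBridge s(v, w)) (ht : t ∈ S.erase x)
    (hw : ∀ s ∈ S.erase x, G.dist x s = G.dist w s) :
    IsResolving G (insert w (S.erase x)) := by
  have hleaf : ∀ a, a ≠ x → G.dist a x = G.dist a v + 1 :=
    fun a ha => dist_eq_add_one_of_leaf hG hx ha
  have hxv1 : G.dist x v = 1 := dist_eq_one_iff_adj.2 hxv
  have hwv1 : G.dist w v = 1 := dist_eq_one_iff_adj.2 hvw.symm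
  have hside : ∀ s ∈ S.erase x, G.dist s w = G.dist s v + 1 := by
    intro s hs
    have := hleaf s (Finset.ne_of_mem_erase hs)
    have := hw s hs
    rw [dist_comm (u := x), dist_comm (u := w)] at this
    omega
  have hxw : G.dist x w = G.dist x v + 1 := by
    have h1 := bridge_cases hG hvw hb x
    have h2 := hG.pos_dist_of_ne hwx.symm
    omega
  -- A partner `b` of `x` on the side of `v` would be adjacent to `v`. Then `w` and `b` look the
  -- same from `S.erase x` and both have distance 2 to the leaf `x`, against `hS`.
  have h1 : ∀ b, b ≠ x → (∀ s ∈ S.erase x, G.dist x s = G.dist b s) →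
      G.dist x w = G.dist b w → G.dist b w = G.dist b v + 1 → False := by
    intro b hbx h h0 hbw
    have hwb : w ≠ b := by
      rintro rfl
      rw [dist_self] at hbw
      omega
    refine dist_ne_of_erase hS hwb (fun s hs => (hw s hs).symm.trans (h s hs)) ?_
    rw [hleaf b hbx, hleaf w hwx]
    omega
  have key : ∀ a b : V, G.dist a w = G.dist b w → G.dist a t = G.dist b t →
      G.dist a v = G.dist a w + 1 → G.dist b w = G.dist b v + 1 → False := by
    intro a b h0 h1 ha hb'
    have e2 := bridge_dist hG hvw hb (hside t ht) ha
    have e6 := hG.dist_triangle (u := b) (v := v) (w := t)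
    rw [dist_comm (u := v)] at e6
    rw [dist_comm (u := t)] at e2
    omega
  intro a b hab
  by_contra! h
  have h0 := h w (Finset.mem_insert_self _ _)
  have h2 : ∀ s ∈ S.erase x, G.dist a s = G.dist b s :=
    fun s hs => h s (Finset.mem_insert_of_mem hs)
  have hne := dist_ne_of_erase hS hab h2
  rcases bridge_cases hG hvw hb a with ha | ha <;> rcases bridge_cases hG hvw hb b with hb' | hb'
  · by_cases hax : a = x
    · subst hax
      exact h1 b hab.symm h2 h0 hb'
    · by_cases hbx : b = x
      · subst hbx
        exact h1 a hab (fun s hs => (h2 s hs).symm) h0.symm ha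
      · rw [hleaf a hax, hleaf b hbx] at hne
        omega
  · exact key b a h0.symm (h2 t ht).symm hb' ha
  · exact key a b h0 (h2 t ht) ha hb'
  · have e1 := hleaf a (by rintro rfl; omega)
    have e2 := hleaf b (by rintro rfl; omega)
    omega

/-- A basis forced leaf at `v` is not distinguished from some other neighbour of `v` by the rest
of a metric basis. -/
theorem exists_twin_of_forced (hG : G.Connected) (hx : x ∈ basisForced G)
    (hS : IsMetricBasis G S) {v : V} (hxv : G.Adj x v) (hleaf : ∀ z, G.Adj x z → z = v) :
    ∃ w, G.Adj v w ∧ w ≠ x ∧ ∀ s ∈ S.erase x, G.dist x s = G.dist w s := by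
  by_contra! hno
  refine not_isResolving_insert_of_forced hx hS hxv.ne' ?_
  intro a b hab
  by_contra! h
  have h0 := h v (Finset.mem_insert_self _ _)
  have h2 : ∀ s ∈ S.erase x, G.dist a s = G.dist b s :=
    fun s hs => h s (Finset.mem_insert_of_mem hs)
  -- Away from `x`, distances to `x` and `v` differ by exactly 1, so replacing `x` by `v` can only
  -- lose pairs containing `x`. The partner in such a pair is a neighbour of `v`.
  have key : ∀ b, b ≠ x → G.dist x v = G.dist b v →
      (∀ s ∈ S.erase x, G.dist x s = G.dist b s) → False := by
    intro b hbx h0 h2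
    rw [dist_eq_one_iff_adj.2 hxv] at h0
    obtain ⟨s, hs, hd⟩ := hno b (dist_eq_one_iff_adj.1 h0.symm).symm hbx
    exact hd (h2 s hs)
  by_cases hax : a = x
  · subst hax
    exact key b hab.symm h0 h2
  · by_cases hbx : b = x
    · subst hbx
      exact key a hab h0.symm fun s hs => (h2 s hs).symm
    · refine dist_ne_of_erase hS.1 hab h2 ?_
      rw [dist_eq_add_one_of_leaf hG hleaf hax, dist_eq_add_one_of_leaf hG hleaf hbx, h0]

end Exchange


/-! ### The cycle with its attached trees -/

/-- Coordinates of a unicyclic graph: `γ 0, …, γ (g - 1)` are the vertices of the cycle in cyclic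
order, and `γ (idx a)` is the vertex of the cycle whose tree contains `a`. -/
structure Coords {V : Type*} (G : SimpleGraph V) (g : ℕ) (γ : ℕ → V) (idx : V → ℕ) : Prop where
  three_le : 3 ≤ g
  idx_lt : ∀ a, idx a < g
  idx_γ : ∀ i < g, idx (γ i) = i
  mem_cycleVerts_γ : ∀ i, γ i ∈ cycleVerts G
  γ_idx : ∀ a ∈ cycleVerts G, γ (idx a) = a
  idx_eq : ∀ v ∈ cycleVerts G, ∀ a ∈ treeAt G v, idx a = idx v
  isBridge : ∀ a b, G.Adj a b → idx a = idx b → G.IsBridge s(a, b)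
  mem_of_adj : ∀ a b, G.Adj a b → idx a ≠ idx b → a ∈ cycleVerts G ∧ b ∈ cycleVerts G
  cyc_of_adj : ∀ a b, G.Adj a b → idx a ≠ idx b → cyc g (idx a) (idx b) = 1
  adj_γ : ∀ i, i + 1 < g → G.Adj (γ i) (γ (i + 1))
  adj_γ_last : G.Adj (γ (g - 1)) (γ 0)

section Construction

variable {V : Type*} {G : SimpleGraph V}

theorem cycleEdges_eq (hG : IsUnicyclic G) {u : V} {c : G.Walk u u} (hc : c.IsCycle) :
    cycleEdges G = {e | e ∈ c.edges} := by
  ext e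
  constructor
  · rintro ⟨v, d, hd, he⟩
    have : {e | e ∈ d.edges} = {e | e ∈ c.edges} := hG.2.unique ⟨v, d, hd, rfl⟩ ⟨u, c, hc, rfl⟩
    exact this ▸ he
  · exact fun he => ⟨u, c, hc, he⟩

theorem exists_lt_length_edge {u v : V} (c : G.Walk u v) {e : Sym2 V} (he : e ∈ c.edges) :
    ∃ i < c.length, e = s(c.getVert i, c.getVert (i + 1)) := by
  induction c with
  | nil => simp at he
  | cons h p ih =>
    rw [Walk.edges_cons, List.mem_cons] at he
    rcases he with rfl | he
    · exact ⟨0, by simp, by simp⟩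
    · obtain ⟨i, hi, rfl⟩ := ih he
      exact ⟨i + 1, by simpa using hi, by simp⟩

theorem mem_support_of_mem_cycleVerts (hG : IsUnicyclic G) {u : V} {c : G.Walk u u}
    (hc : c.IsCycle) {a : V} (ha : a ∈ cycleVerts G) : a ∈ c.support := by
  obtain ⟨v, d, hd, had⟩ := ha
  have hE : {e | e ∈ d.edges} = {e | e ∈ c.edges} := hG.2.unique ⟨v, d, hd, rfl⟩ ⟨u, c, hc, rfl⟩
  obtain ⟨e, he, hae⟩ := (Walk.mem_support_iff_exists_mem_edges_of_not_nil hd.not_nil).1 had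
  have hec : e ∈ c.edges := by
    have : e ∈ {e | e ∈ d.edges} := he
    rwa [hE] at this
  exact Walk.mem_support_of_mem_edges hec hae

theorem mem_cycleVerts_of_mem_cycleEdges {a b : V} (h : s(a, b) ∈ cycleEdges G) :
    a ∈ cycleVerts G ∧ b ∈ cycleVerts G := by
  obtain ⟨u, c, hc, he⟩ := h
  exact ⟨⟨u, c, hc, c.fst_mem_support_of_mem_edges he⟩,
    ⟨u, c, hc, c.snd_mem_support_of_mem_edges he⟩⟩

theorem isBridge_of_notMem_cycleEdges {a b : V} (hab : G.Adj a b) (h : s(a, b) ∉ cycleEdges G) :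
    G.IsBridge s(a, b) :=
  (isBridge_iff_forall_cycle_notMem ((mem_edgeSet G).2 hab)).2
    fun u p hp hep => h ⟨u, p, hp, hep⟩

/-- Otherwise the first edge of a path joining them outside `E(C)` would be a bridge, yet its ends
stay connected through the rest of the path and the cycle. -/
theorem eq_of_reachable_delete_cycleEdges (hG : IsUnicyclic G) {v w : V}
    (hv : v ∈ cycleVerts G) (hw : w ∈ cycleVerts G)
    (h : (G.deleteEdges (cycleEdges G)).Reachable v w) : v = w := by
  classical
  obtain ⟨P, hP⟩ := h.exists_isPath
  cases P with
  | nil => rfl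
  | @cons _ y _ hvy p =>
    exfalso
    rw [deleteEdges_adj] at hvy
    obtain ⟨hvy, hne⟩ := hvy
    have hbr := isBridge_of_notMem_cycleEdges hvy hne
    rw [isBridge_iff] at hbr
    obtain ⟨E, ⟨u, c, hc, -⟩, -⟩ := hG.2
    have hcE := cycleEdges_eq hG hc
    have hvc := mem_support_of_mem_cycleVerts hG hc hv
    have hwc := mem_support_of_mem_cycleVerts hG hc hw
    have hnc : s(v, y) ∉ c.edges := fun h => hne (by rw [hcE]; exact h)
    have hu : ∀ a ∈ c.support, (G.deleteEdges {s(v, y)}).Reachable u a := fun a ha =>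
      reachable_deleteEdges_iff_exists_walk.2
        ⟨c.takeUntil a ha, fun h => hnc (c.edges_takeUntil_subset_edges ha h)⟩
    rw [Walk.cons_isPath_iff] at hP
    have hyw : (G.deleteEdges {s(v, y)}).Reachable y w := by
      refine reachable_deleteEdges_iff_exists_walk.2
        ⟨p.map (.ofLE (deleteEdges_le _)), fun h => hP.2 ?_⟩
      have := Walk.fst_mem_support_of_mem_edges _ h
      simpa using this
    exact hbr (((hu v hvc).symm.trans (hu w hwc)).trans hyw.symm)

theorem exists_mem_cycleVerts_reachable (hG : IsUnicyclic G) (a : V) :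
    ∃ v ∈ cycleVerts G, (G.deleteEdges (cycleEdges G)).Reachable v a := by
  obtain ⟨E, ⟨u, c, hc, -⟩, -⟩ := hG.2
  have hu : u ∈ cycleVerts G := ⟨u, c, hc, c.start_mem_support⟩
  obtain ⟨p⟩ := hG.1.preconnected a u
  clear hc
  induction p with
  | nil => exact ⟨_, hu, .rfl⟩
  | @cons a b _ hab p ih =>
    by_cases he : s(a, b) ∈ cycleEdges G
    · exact ⟨a, (mem_cycleVerts_of_mem_cycleEdges he).1, .rfl⟩
    · obtain ⟨v, hv, hvb⟩ := ih c hu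
      refine ⟨v, hv, hvb.trans (Adj.reachable ?_)⟩
      rw [deleteEdges_adj]
      exact ⟨hab.symm, by rwa [Sym2.eq_swap]⟩

theorem exists_coords (hG : IsUnicyclic G) : ∃ g γ idx, Coords G g γ idx := by
  obtain ⟨E, ⟨u, c, hc, -⟩, -⟩ := id hG.2
  have hcE := cycleEdges_eq hG hc
  have h3 := hc.three_le_length
  have hmem : ∀ i, c.getVert i ∈ cycleVerts G := fun i => ⟨u, c, hc, c.getVert_mem_support i⟩
  have hex : ∀ a : V, ∃ i < c.length,
      (G.deleteEdges (cycleEdges G)).Reachable (c.getVert i) a := by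
    intro a
    obtain ⟨v, hv, hva⟩ := exists_mem_cycleVerts_reachable hG a
    obtain ⟨i, rfl, hi⟩ := Walk.mem_support_iff_exists_getVert.1
      (mem_support_of_mem_cycleVerts hG hc hv)
    rcases hi.lt_or_eq with hi | rfl
    · exact ⟨i, hi, hva⟩
    -- The closed walk visits its base point at index `c.length` too; index `0` is used instead.
    · refine ⟨0, by omega, ?_⟩
      rwa [Walk.getVert_zero, ← Walk.getVert_length c]
  choose idx hlt hidx using hex
  have hinj : ∀ i < c.length, ∀ j < c.length, c.getVert i = c.getVert j → i = j :=
    fun i hi j hj h => hc.getVert_injOn' (by simp; omega) (by simp; omega) h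
  have hgi : ∀ a ∈ cycleVerts G, c.getVert (idx a) = a := fun a ha =>
    eq_of_reachable_delete_cycleEdges hG (hmem _) ha (hidx a)
  have higet : ∀ i < c.length, idx (c.getVert i) = i := fun i hi =>
    hinj _ (hlt _) _ hi (hgi _ (hmem i))
  have hreach : ∀ a b, (G.deleteEdges (cycleEdges G)).Reachable a b → idx a = idx b :=
    fun a b h => hinj _ (hlt a) _ (hlt b) (eq_of_reachable_delete_cycleEdges hG (hmem _) (hmem _)
      (((hidx a).trans h).trans (hidx b).symm))
  have hedge : ∀ a b, G.Adj a b → idx a ≠ idx b → s(a, b) ∈ cycleEdges G := by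
    intro a b hab hne
    by_contra h
    exact hne (hreach a b (Adj.reachable (by rw [deleteEdges_adj]; exact ⟨hab, h⟩)))
  have hcyc : ∀ i < c.length,
      cyc c.length (idx (c.getVert i)) (idx (c.getVert (i + 1))) = 1 := by
    intro i hi
    rw [higet i hi]
    by_cases h : i + 1 < c.length
    · rw [higet _ h]
      unfold cyc; omega
    · have : c.getVert (i + 1) = c.getVert 0 := by
        rw [Walk.getVert_zero, show i + 1 = c.length by omega, Walk.getVert_length]
      rw [this, higet 0 (by omega)]
      unfold cyc; omega
  refine ⟨c.length, c.getVert, idx, h3, hlt, higet, hmem, hgi, fun v _ a ha => (hreach v a ha).symm,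
    fun a b hab he => ?_, fun a b hab hne => mem_cycleVerts_of_mem_cycleEdges (hedge a b hab hne),
    fun a b hab hne => ?_, fun i hi => c.adj_getVert_succ (by omega), ?_⟩
  · refine isBridge_of_notMem_cycleEdges hab fun h => ?_
    have hm := mem_cycleVerts_of_mem_cycleEdges h
    apply hab.ne
    rw [← hgi a hm.1, ← hgi b hm.2, he]
  · have he := hedge a b hab hne
    rw [hcE] at he
    obtain ⟨i, hi, h⟩ := exists_lt_length_edge c he
    rcases Sym2.eq_iff.1 h with ⟨rfl, rfl⟩ | ⟨rfl, rfl⟩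
    · exact hcyc i hi
    · rw [cyc_comm]; exact hcyc i hi
  · have := c.adj_getVert_succ (i := c.length - 1) (by omega)
    rw [show c.length - 1 + 1 = c.length by omega, Walk.getVert_length] at this
    rwa [Walk.getVert_zero]

end Construction

/-! ### The metric in coordinates, and forced vertices -/

namespace Coords

variable {V : Type*} {G : SimpleGraph V} {g : ℕ} {γ : ℕ → V} {idx : V → ℕ}

/-- The projection to the cycle is 1-Lipschitz: an edge either stays in a tree or moves `idx` by one
step. -/
theorem cyc_le_dist (h : Coords G g γ idx) (hG : G.Connected) (a b : V) :
    cyc g (idx a) (idx b) ≤ G.dist a b := by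
  obtain ⟨p, hp⟩ := hG.exists_walk_length_eq_dist a b
  rw [← hp]
  clear hp
  induction p with
  | nil => rw [cyc_self]; exact Nat.zero_le _
  | @cons a b c hab p ih =>
    rw [Walk.length_cons]
    by_cases he : idx a = idx b
    · rw [he]; omega
    · have h1 := h.cyc_of_adj a b hab he
      have h2 := cyc_triangle (h.idx_lt a) (h.idx_lt b) (h.idx_lt c)
      omega

theorem dist_γ_add_le (h : Coords G g γ idx) (hG : G.Connected) (i n : ℕ) (hin : i + n < g) :
    G.dist (γ i) (γ (i + n)) ≤ n := by
  induction n with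
  | zero => simp
  | succ n ih =>
    have h1 := hG.dist_triangle (u := γ i) (v := γ (i + n)) (w := γ (i + n + 1))
    rw [dist_eq_one_iff_adj.2 (h.adj_γ (i + n) (by omega))] at h1
    have := ih (by omega)
    rw [← add_assoc]
    omega

theorem dist_γ_of_le (h : Coords G g γ idx) (hG : G.Connected) {i j : ℕ} (hij : i ≤ j)
    (hj : j < g) : G.dist (γ i) (γ j) = cyc g i j := by
  have h0 := h.cyc_le_dist hG (γ i) (γ j)
  rw [h.idx_γ i (by omega), h.idx_γ j hj] at h0
  have h1 := h.dist_γ_add_le hG i (j - i) (by omega)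
  rw [show i + (j - i) = j by omega] at h1
  have h2 := h.dist_γ_add_le hG 0 i (by omega)
  rw [zero_add] at h2
  have h3 := h.dist_γ_add_le hG j (g - 1 - j) (by omega)
  rw [show j + (g - 1 - j) = g - 1 by omega] at h3
  have h4 := hG.dist_triangle (u := γ j) (v := γ (g - 1)) (w := γ i)
  have h5 := hG.dist_triangle (u := γ (g - 1)) (v := γ 0) (w := γ i)
  rw [dist_eq_one_iff_adj.2 h.adj_γ_last] at h5
  rw [dist_comm (u := γ j) (v := γ i)] at h4
  unfold cyc at h0 ⊢
  omega

theorem dist_γ (h : Coords G g γ idx) (hG : G.Connected) {i j : ℕ} (hi : i < g)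
    (hj : j < g) : G.dist (γ i) (γ j) = cyc g i j := by
  rcases le_total i j with hij | hij
  · exact h.dist_γ_of_le hG hij hj
  · rw [dist_comm, cyc_comm]; exact h.dist_γ_of_le hG hij hi

/-- A walk that leaves the tree of `a` does so along an edge of the cycle, hence through the root.
-/
theorem dist_eq_add (h : Coords G g γ idx) (hG : G.Connected) {a b : V} (hab : idx a ≠ idx b) :
    G.dist a b = G.dist a (γ (idx a)) + G.dist (γ (idx a)) b := by
  refine le_antisymm hG.dist_triangle ?_
  obtain ⟨p, hp⟩ := hG.exists_walk_length_eq_dist a b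
  rw [← hp]
  clear hp
  induction p with
  | nil => exact absurd rfl hab
  | @cons a b c hac p ih =>
    rw [Walk.length_cons]
    by_cases he : idx a = idx b
    · have h1 := ih (he ▸ hab)
      have h2 := hG.dist_triangle (u := a) (v := b) (w := γ (idx a))
      rw [dist_eq_one_iff_adj.2 hac] at h2
      rw [he] at h2 ⊢
      omega
    · have h1 := h.γ_idx a (h.mem_of_adj a b hac he).1
      have h2 := dist_le (Walk.cons hac p)
      rw [h1, dist_self, zero_add]
      rwa [Walk.length_cons] at h2

/-- The distance from a vertex to the cycle. -/
theorem dist_eq (h : Coords G g γ idx) (hG : G.Connected) {a b : V} (hab : idx a ≠ idx b) :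
    G.dist a b =
      G.dist a (γ (idx a)) + cyc g (idx a) (idx b) + G.dist b (γ (idx b)) := by
  have h1 := h.idx_γ (idx a) (h.idx_lt a)
  have h2 := h.dist_eq_add hG hab
  have h3 := h.dist_eq_add hG (a := b) (b := γ (idx a)) (by rw [h1]; exact hab.symm)
  rw [dist_comm (u := γ (idx b)), h.dist_γ hG (h.idx_lt a) (h.idx_lt b)] at h3
  rw [dist_comm (u := γ (idx a))] at h2
  omega


/-- A resolving set is not contained in the tree of a single vertex of the cycle. -/
theorem exists_idx_ne (h : Coords G g γ idx) (hG : G.Connected) {S : Finset V}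
    (hS : IsResolving G S) (i : ℕ) : ∃ s ∈ S, idx s ≠ i := by
  by_contra! hall
  have hg := h.three_le
  have hne : S.Nonempty := by
    obtain ⟨s, hs, -⟩ := hS (γ 0) (γ 1) (fun e => by
      have := congrArg idx e
      rw [h.idx_γ 0 (by omega), h.idx_γ 1 (by omega)] at this
      omega)
    exact ⟨s, hs⟩
  obtain ⟨s₀, hs₀⟩ := hne
  have hi : i < g := hall s₀ hs₀ ▸ h.idx_lt s₀
  -- The two cycle neighbours of `γ i`, distinct because `3 ≤ g`; no vertex in the tree at `γ i`
  -- tells them apart.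
  obtain ⟨j, k, hj, hk, hjk, hji, hki, hjc, hkc⟩ : ∃ j k, j < g ∧ k < g ∧ j ≠ k ∧ j ≠ i ∧ k ≠ i ∧
      cyc g j i = 1 ∧ cyc g k i = 1 := by
    refine ⟨if i + 1 < g then i + 1 else 0, if i = 0 then g - 1 else i - 1, ?_⟩
    unfold cyc
    split <;> split <;> omega
  obtain ⟨s, hs, hd⟩ := hS (γ j) (γ k) (fun e => hjk (by
    rw [← h.idx_γ j hj, ← h.idx_γ k hk, e]))
  apply hd
  have e1 := h.idx_γ j hj
  have e2 := h.idx_γ k hk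
  have e3 := hall s hs
  rw [h.dist_eq hG (a := γ j) (by omega), h.dist_eq hG (a := γ k) (by omega), e1, e2, e3, hjc, hkc,
    dist_self, dist_self]

theorem erase_nonempty [DecidableEq V] (h : Coords G g γ idx) (hG : G.Connected) {S : Finset V}
    (hS : IsResolving G S) (x : V) : (S.erase x).Nonempty := by
  obtain ⟨s, hs, hne⟩ := h.exists_idx_ne hG hS (idx x)
  exact ⟨s, Finset.mem_erase.2 ⟨fun e => hne (e ▸ rfl), hs⟩⟩

/-- Removing a basis forced vertex from a metric basis does not affect pairs of vertices of the
same tree at the same distance from the cycle. -/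
theorem exists_dist_ne_of_forced [DecidableEq V] (h : Coords G g γ idx) (hG : G.Connected)
    {S : Finset V} {x : V} (hx : x ∈ basisForced G) (hS : IsMetricBasis G S) {u w : V}
    (huw : u ≠ w) (hi : idx u = idx w)
    (hd : G.dist u (γ (idx u)) = G.dist w (γ (idx w))) :
    ∃ r ∈ S.erase x, G.dist u r ≠ G.dist w r := by
  by_contra! hr
  have hne := dist_ne_of_erase hS.1 huw hr
  -- From outside their tree, `u` and `w` are seen only through the root, at equal depth.
  have hxu : idx u = idx x := by
    by_contra hc
    rw [h.dist_eq_add hG hc, h.dist_eq_add hG (a := w) (hi ▸ hc), hd, hi] at hne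
    exact hne rfl
  have hxγ : x ≠ γ (idx x) := by
    intro e
    rw [← hi] at hd
    rw [e, ← hxu] at hne
    exact hne hd
  have hxC : x ∉ cycleVerts G := fun hc => hxγ (h.γ_idx x hc).symm
  have hidx : ∀ y, G.Adj x y → idx x = idx y := fun y hy => by
    by_contra hc
    exact hxC (h.mem_of_adj x y hy hc).1
  obtain ⟨t, ht⟩ := h.erase_nonempty hG hS.1 x
  obtain ⟨v, hxv, hleaf⟩ := exists_unique_adj_of_forced hG hx hS ⟨t, ht⟩
    fun y hy => h.isBridge x y hy (hidx y hy)
  have htwin : ∀ w, G.Adj v w → w ≠ x → (∀ s ∈ S.erase x, G.dist x s = G.dist w s) →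
      ¬ G.IsBridge s(v, w) := fun w hvw hwx hw hb =>
    not_isResolving_insert_of_forced hx hS hwx
      (isResolving_insert_of_twin hG hS.1 hxv hleaf hvw hwx hb ht hw)
  obtain ⟨w', hvw', hwx', hw'⟩ := exists_twin_of_forced hG hx hS hxv hleaf
  -- The leaf `x` has a twin at `v`, and a twin along a bridge could replace `x`. So the edge to the
  -- twin is no bridge and `v` lies on the cycle, which makes `v` the root for `u` and `w`.
  have hvC : v ∈ cycleVerts G := by
    by_contra hvC
    refine htwin w' hvw' hwx' hw' (h.isBridge v w' hvw' ?_)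
    by_contra hc
    exact hvC (h.mem_of_adj v w' hvw' hc).1
  have hvx := hidx v hxv
  have hvγ : γ (idx x) = v := by rw [hvx]; exact h.γ_idx v hvC
  have key : ∀ w, w ≠ x → idx x = idx w → G.dist x v = G.dist w v →
      (∀ s ∈ S.erase x, G.dist x s = G.dist w s) → False := by
    intro w hwx hi hd hw
    rw [dist_eq_one_iff_adj.2 hxv] at hd
    have hvw := (dist_eq_one_iff_adj.1 hd.symm).symm
    exact htwin w hvw hwx hw (h.isBridge v w hvw (by rw [← hvx, hi]))
  rw [← hi, hxu, hvγ] at hd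
  by_cases hux : u = x
  · subst hux
    exact key w huw.symm hi hd hr
  · by_cases hwx : w = x
    · subst hwx
      exact key u hux hi.symm hd.symm fun s hs => (hr s hs).symm
    · rw [dist_eq_add_one_of_leaf hG hleaf hux, dist_eq_add_one_of_leaf hG hleaf hwx, hd] at hne
      exact hne rfl

/-- If `u` and `w` lie in the trees of different vertices of the cycle and have the same distance
to vertices of two different trees, then those distances are determined on the cycle. -/
theorem cyc_sub_cyc_eq (h : Coords G g γ idx) (hG : G.Connected) {u w r s : V}
    (huw : idx u ≠ idx w) (hrs : idx r ≠ idx s) (hr : G.dist u r = G.dist w r)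
    (hs : G.dist u s = G.dist w s) :
    (cyc g (idx u) (idx r) : ℤ) - cyc g (idx w) (idx r) =
      (G.dist w (γ (idx w)) : ℤ) - G.dist u (γ (idx u)) := by
  have hself := cyc_self g
  have hpos := cyc_pos (h.idx_lt u) (h.idx_lt w) huw
  have tri : ∀ v, cyc g (idx u) (idx w) ≤ cyc g (idx u) (idx v) + cyc g (idx w) (idx v) ∧
      cyc g (idx u) (idx v) ≤ cyc g (idx u) (idx w) + cyc g (idx w) (idx v) ∧
      cyc g (idx w) (idx v) ≤ cyc g (idx u) (idx w) + cyc g (idx u) (idx v) := fun v => by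
    refine ⟨?_, cyc_triangle (h.idx_lt _) (h.idx_lt _) (h.idx_lt _), ?_⟩
    · rw [cyc_comm g (idx w) (idx v)]
      exact cyc_triangle (h.idx_lt _) (h.idx_lt _) (h.idx_lt _)
    · rw [cyc_comm g (idx u) (idx w)]
      exact cyc_triangle (h.idx_lt _) (h.idx_lt _) (h.idx_lt _)
  -- A vertex outside both trees gives the claimed equality. One inside the tree of `u` or `w` gives
  -- only an inequality; the vertex in a different tree supplies the reverse one, via the triangle
  -- inequality on the cycle.
  have key : ∀ v, G.dist u v = G.dist w v →
      (idx v ≠ idx u → idx v ≠ idx w → (cyc g (idx u) (idx v) : ℤ) - cyc g (idx w) (idx v) =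
        (G.dist w (γ (idx w)) : ℤ) - G.dist u (γ (idx u))) ∧
      (idx v = idx u → G.dist w (γ (idx w)) + cyc g (idx u) (idx w) ≤ G.dist u (γ (idx u))) ∧
      (idx v = idx w → G.dist u (γ (idx u)) + cyc g (idx u) (idx w) ≤ G.dist w (γ (idx w))) := by
    intro v hv
    refine ⟨fun h1 h2 => ?_, fun h1 => ?_, fun h1 => ?_⟩
    · rw [h.dist_eq hG h1.symm, h.dist_eq hG h2.symm] at hv
      omega
    · rw [h.dist_eq hG (a := w) (by rw [h1]; exact huw.symm), h1, cyc_comm] at hv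
      have := hG.dist_triangle (u := u) (v := γ (idx u)) (w := v)
      rw [dist_comm (u := γ (idx u))] at this
      omega
    · rw [h.dist_eq hG (a := u) (by rw [h1]; exact huw), h1] at hv
      have := hG.dist_triangle (u := w) (v := γ (idx w)) (w := v)
      rw [dist_comm (u := γ (idx w))] at this
      omega
  have kr := key r hr
  have ks := key s hs
  have ts := tri s
  by_cases h1 : idx r = idx u
  · have k1 := kr.2.1 h1
    rw [h1, hself, cyc_comm g (idx w)]
    by_cases h2 : idx s = idx w
    · have := ks.2.2 h2
      omega
    · have := ks.1 (fun e => hrs (h1.trans e.symm)) h2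
      omega
  · by_cases h2 : idx r = idx w
    · have k1 := kr.2.2 h2
      rw [h2, hself]
      by_cases h3 : idx s = idx u
      · have := ks.2.1 h3
        omega
      · have := ks.1 h3 (fun e => hrs (h2.trans e.symm))
        omega
    · exact kr.1 h1 h2

/-- Removing a basis forced vertex from a metric basis leaves vertices of a single tree. -/
theorem idx_eq_of_forced [DecidableEq V] (h : Coords G g γ idx) (hG : G.Connected)
    {S : Finset V} {x : V} (hx : x ∈ basisForced G) (hS : IsMetricBasis G S) {r s : V}
    (hr : r ∈ S.erase x) (hs : s ∈ S.erase x) : idx r = idx s := by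
  by_contra hrs
  obtain ⟨c, hc, hcx, hcyc⟩ :=
    exists_doubly_resolving h.three_le (h.idx_lt r) (h.idx_lt s) hrs (idx x)
  have hγx : γ c ≠ x := by
    rintro rfl
    exact hcx (h.idx_γ c hc).symm
  refine not_isResolving_insert_of_forced hx hS hγx fun u w huw => ?_
  by_contra! hall
  have h0 := hall (γ c) (Finset.mem_insert_self _ _)
  have hR : ∀ t ∈ S.erase x, G.dist u t = G.dist w t :=
    fun t ht => hall t (Finset.mem_insert_of_mem ht)
  by_cases hi : idx u = idx w
  -- As `r` and `s` are in different trees, one is outside the tree of `u` and `w`; it shows that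
  -- they have equal depth.
  · obtain ⟨t, ht, htu⟩ : ∃ t ∈ S.erase x, idx u ≠ idx t := by
      by_cases e : idx u = idx r
      · exact ⟨s, hs, by rwa [e]⟩
      · exact ⟨r, hr, e⟩
    have e := hR t ht
    rw [h.dist_eq hG htu, h.dist_eq hG (a := w) (b := t) (hi ▸ htu), ← hi] at e
    obtain ⟨t', ht', hne⟩ := h.exists_dist_ne_of_forced hG hx hS huw hi (by rw [← hi]; omega)
    exact hne (hR t' ht')
  · apply hi
    have e1 := h.cyc_sub_cyc_eq hG hi hrs (hR r hr) (hR s hs)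
    have e2 := h.cyc_sub_cyc_eq hG hi (Ne.symm hrs) (hR s hs) (hR r hr)
    have e3 : (cyc g (idx u) c : ℤ) - cyc g (idx w) c =
        (G.dist w (γ (idx w)) : ℤ) - G.dist u (γ (idx u)) := by
      have hcc := h.idx_γ c hc
      -- The comparison needs a second vertex in a tree other than that of `γ c`: `s` if `c` is the
      -- root index of `r`, and `r` otherwise.
      by_cases e : c = idx r
      · have := h.cyc_sub_cyc_eq hG (r := γ c) hi (by rw [hcc, e]; exact hrs) h0 (hR s hs)
        rwa [hcc] at this
      · have := h.cyc_sub_cyc_eq hG (r := γ c) hi (by rw [hcc]; exact e) h0 (hR r hr)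
        rwa [hcc] at this
    exact hcyc _ (h.idx_lt u) _ (h.idx_lt w) (e1.trans e2.symm) (e1.trans e3.symm)

/-- The tree at a branch-active vertex has two vertices at the same distance from the cycle. -/
theorem exists_pair_of_isBranchActive [Finite V] (h : Coords G g γ idx) (hG : G.Connected) {v : V}
    (hv : IsBranchActive G v) : ∃ p q, p ≠ q ∧ idx p = idx v ∧ idx q = idx v ∧
      G.dist p v = G.dist q v := by
  obtain ⟨hvC, u, huT, hu⟩ := hv
  have hidx := h.idx_eq v hvC u huT
  rcases hu with ⟨huC, hdeg⟩ | ⟨huC, hdeg⟩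
  · have huv : u = v := by rw [← h.γ_idx u huC, hidx, h.γ_idx v hvC]
    subst huv
    -- At most two neighbours of `u` lie on the cycle, so degree at least 4 leaves two in the tree,
    -- both at depth 1.
    have hsub : ({y ∈ G.neighborSet u | idx y ≠ idx u} : Set V).ncard ≤ 2 := by
      have : ({y ∈ G.neighborSet u | idx y ≠ idx u} : Set V) ⊆
          {γ (if idx u + 1 < g then idx u + 1 else 0),
            γ (if idx u = 0 then g - 1 else idx u - 1)} := by
        rintro y ⟨hy, hne⟩
        have h1 := h.cyc_of_adj u y hy hne.symm
        have h2 := h.γ_idx y (h.mem_of_adj u y hy hne.symm).2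
        have h3 := h.three_le
        have h4 := h.idx_lt u
        have h5 := h.idx_lt y
        rw [Set.mem_insert_iff, Set.mem_singleton_iff]
        have : idx y = (if idx u + 1 < g then idx u + 1 else 0) ∨
            idx y = if idx u = 0 then g - 1 else idx u - 1 := by
          unfold cyc at h1
          split <;> split <;> omega
        rcases this with e | e
        · left; rw [← e, h2]
        · right; rw [← e, h2]
      exact (Set.ncard_le_ncard this (Set.toFinite _)).trans (Set.ncard_insert_le _ _ |>.trans
        (by rw [Set.ncard_singleton]))
    have hunion := Set.ncard_union_le {y ∈ G.neighborSet u | idx y ≠ idx u}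
      {y ∈ G.neighborSet u | idx y = idx u}
    have heq : {y ∈ G.neighborSet u | idx y ≠ idx u} ∪ {y ∈ G.neighborSet u | idx y = idx u} =
        G.neighborSet u := by
      ext y
      by_cases e : idx y = idx u <;> simp [e]
    rw [heq] at hunion
    obtain ⟨p, hp, q, hq, hpq⟩ := (Set.one_lt_ncard (Set.toFinite _)).1
      (show 1 < {y ∈ G.neighborSet u | idx y = idx u}.ncard by omega)
    refine ⟨p, q, hpq, hp.2, hq.2, ?_⟩
    rw [dist_eq_one_iff_adj.2 (G.adj_symm hp.1), dist_eq_one_iff_adj.2 (G.adj_symm hq.1)]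
  · have hadj : ∀ y, G.Adj u y → idx u = idx y := fun y hy => by
      by_contra hc
      exact huC (h.mem_of_adj u y hy hc).1
    have hbr : ∀ y, G.Adj u y → G.IsBridge s(u, y) := fun y hy => h.isBridge u y hy (hadj y hy)
    have hvu : v ≠ u := by rintro rfl; exact huC hvC
    obtain ⟨z, huz, hz⟩ := exists_adj_dist_eq_add_one hG hvu
    -- Besides the neighbour `z` towards the cycle there are two more, each one step deeper than
    -- `u`.
    have hcard : 1 < (G.neighborSet u \ {z}).ncard := by
      have := Set.ncard_sdiff_singleton_add_one (s := G.neighborSet u) (a := z) huz (Set.toFinite _)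
      omega
    obtain ⟨p, hp, q, hq, hpq⟩ := (Set.one_lt_ncard (Set.toFinite _)).1 hcard
    have hd : ∀ y ∈ G.neighborSet u \ {z}, G.dist y v = G.dist v u + 1 := fun y hy => by
      rw [SimpleGraph.dist_comm]
      exact bridge_unique hG huz hy.1 (hbr y hy.1) (fun e => hy.2 e.symm) hz
    exact ⟨p, q, hpq, (hadj p hp.1).symm.trans hidx, (hadj q hq.1).symm.trans hidx,
      (hd p hp).trans (hd q hq).symm⟩

/-- The tree at a branch-active vertex meets a metric basis without a basis forced vertex. -/
theorem exists_mem_erase_idx_eq [Finite V] [DecidableEq V] (h : Coords G g γ idx)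
    (hG : G.Connected) {S : Finset V} {x : V} (hx : x ∈ basisForced G) (hS : IsMetricBasis G S)
    {v : V} (hv : IsBranchActive G v) : ∃ r ∈ S.erase x, idx r = idx v := by
  obtain ⟨p, q, hpq, hp, hq, hd⟩ := h.exists_pair_of_isBranchActive hG hv
  have hγ := h.γ_idx v hv.1
  obtain ⟨r, hr, hne⟩ := h.exists_dist_ne_of_forced hG hx hS hpq (hp.trans hq.symm)
    (by rw [hp, hq, hγ, hd])
  refine ⟨r, hr, ?_⟩
  by_contra hc
  apply hne
  rw [h.dist_eq_add hG (a := p) (by rw [hp]; exact Ne.symm hc),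
    h.dist_eq_add hG (a := q) (by rw [hq]; exact Ne.symm hc), hp, hq, hγ, hd]

end Coords

/-! ### The classification -/

theorem exists_isMetricBasis {V : Type*} [Finite V] {G : SimpleGraph V} (hG : G.Connected) :
    ∃ S : Finset V, IsMetricBasis G S := by
  classical
  cases nonempty_fintype V
  have hne : (Finset.univ.filter fun S : Finset V => IsResolving G S).Nonempty := by
    refine ⟨Finset.univ, ?_⟩
    simp only [Finset.mem_filter, Finset.mem_univ, true_and]
    refine fun u v huv => ⟨u, Finset.mem_univ _, ?_⟩
    rw [dist_self]
    exact (hG.pos_dist_of_ne huv.symm).ne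
  obtain ⟨S, hS, hmin⟩ := Finset.exists_min_image _ Finset.card hne
  simp only [Finset.mem_filter, Finset.mem_univ, true_and] at hS hmin
  exact ⟨S, hS, hmin⟩

/-- The classification of the unicyclic graphs with a basis forced vertex. -/
theorem isType_of_nonempty {V : Type*} [Finite V] {G : SimpleGraph V} (hG : IsUnicyclic G)
    (hne : (basisForced G).Nonempty) : IsTypeI G ∨ IsTypeII G ∨ IsTypeIII G := by
  classical
  obtain ⟨g, γ, idx, h⟩ := exists_coords hG
  obtain ⟨S, hS⟩ := exists_isMetricBasis hG.1
  obtain ⟨x, hx⟩ := hne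
  have hact : ∀ y ∈ basisForced G, ∀ r ∈ S.erase y, ∀ v, IsBranchActive G v →
      idx v = idx r := by
    intro y hy r hr v hv
    obtain ⟨s, hs, hsv⟩ := h.exists_mem_erase_idx_eq hG.1 hy hS hv
    exact hsv.symm.trans (h.idx_eq_of_forced hG.1 hy hS hs hr)
  by_cases hx' : ∃ y ∈ basisForced G, y ≠ x
  · obtain ⟨y, hy, hyx⟩ := hx'
    left
    have hyS : y ∈ S.erase x := Finset.mem_erase.2 ⟨hyx, hy S hS⟩
    have hxS : x ∈ S.erase y := Finset.mem_erase.2 ⟨hyx.symm, hx S hS⟩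
    -- Otherwise `S.erase x` lies in the tree of `y`, which also contains `x`, so all of `S` would
    -- lie in one tree.
    have hidx : idx x ≠ idx y := by
      intro e
      obtain ⟨s, hs, hsi⟩ := h.exists_idx_ne hG.1 hS.1 (idx x)
      have : s ∈ S.erase x := Finset.mem_erase.2 ⟨fun e => hsi (e ▸ rfl), hs⟩
      exact hsi ((h.idx_eq_of_forced hG.1 hx hS this hyS).trans e.symm)
    have hSeq : S = {x, y} := by
      ext s
      simp only [Finset.mem_insert, Finset.mem_singleton]
      refine ⟨fun hs => ?_, ?_⟩
      · by_contra! hc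
        have h1 := h.idx_eq_of_forced hG.1 hx hS (Finset.mem_erase.2 ⟨hc.1, hs⟩) hyS
        have h2 := h.idx_eq_of_forced hG.1 hy hS (Finset.mem_erase.2 ⟨hc.2, hs⟩) hxS
        exact hidx (h2.symm.trans h1)
      · rintro (rfl | rfl)
        · exact hx S hS
        · exact hy S hS
    refine ⟨?_, ?_, S, hS, fun T hT => ?_⟩
    · have : {v | IsBranchActive G v} = ∅ := by
        ext v
        simp only [Set.mem_ofPred_eq, Set.mem_empty_iff_false, iff_false]
        exact fun hv => hidx ((hact y hy x hxS v hv).symm.trans (hact x hx y hyS v hv))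
      rw [b, this, Set.ncard_empty]
    · have : basisForced G = {x, y} := by
        ext s
        refine ⟨fun hs => ?_, ?_⟩
        · have := hs S hS
          rw [hSeq] at this
          simpa using this
        · rintro (rfl | rfl)
          · exact hx
          · exact hy
      rw [this, Set.ncard_pair hyx.symm]
    · have hsub : S ⊆ T := by
        rw [hSeq]
        intro s hs
        simp only [Finset.mem_insert, Finset.mem_singleton] at hs
        rcases hs with rfl | rfl
        · exact hx T hT
        · exact hy T hT
      exact (Finset.eq_of_subset_of_card_le hsub (hT.2 S hS.1)).symm
  · push Not at hx'
    right
    have h1 : (basisForced G).ncard = 1 := by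
      rw [Set.ncard_eq_one]
      exact ⟨x, Set.eq_singleton_iff_unique_mem.2 ⟨hx, hx'⟩⟩
    obtain ⟨r, hr⟩ := h.erase_nonempty hG.1 hS.1 x
    have hb : b G ≤ 1 := by
      rw [b, Set.ncard_le_one (Set.toFinite _)]
      intro v hv w hw
      rw [← h.γ_idx v hv.1, ← h.γ_idx w hw.1, hact x hx r hr v hv, hact x hx r hr w hw]
    rcases Nat.le_one_iff_eq_zero_or_eq_one.1 hb with hb | hb
    · exact Or.inl ⟨hb, h1⟩
    · exact Or.inr ⟨hb, h1⟩


/-! ### Finite criteria for the examples -/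

section Criteria

variable {V : Type*} {G : SimpleGraph V}

/-- A connected graph with as many edges as vertices that has a cycle is unicyclic. -/
theorem isUnicyclic_of_card [Finite V] (hG : G.Connected)
    (hcard : Nat.card G.edgeSet = Nat.card V) {u : V} {c : G.Walk u u} (hc : c.IsCycle) :
    IsUnicyclic G := by
  have key : ∀ {u v : V} (c : G.Walk u u) (d : G.Walk v v), c.IsCycle → d.IsCycle →
      ∀ e ∈ c.edges, e ∈ d.edges := by
    intro u v c d hc hd e
    induction e with
    | h x y =>
      intro he
      by_contra hed
      -- Deleting an edge of `c` that is not on `d` leaves a connected graph with one edge fewer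
      -- than vertices, a tree that still contains the cycle `d`.
      have hcon := hG.connected_delete_edge_of_not_isBridge
        fun h : G.IsBridge s(x, y) => h.notMem_edges_of_isCycle hc he
      have htree : (G.deleteEdges {s(x, y)}).IsTree := by
        rw [isTree_iff_connected_and_card]
        refine ⟨hcon, ?_⟩
        rw [← hcard, edgeSet_deleteEdges, Nat.card_coe_set_eq, Nat.card_coe_set_eq]
        exact Set.ncard_sdiff_singleton_add_one (c.edges_subset_edgeSet he) (Set.toFinite _)
      exact htree.isAcyclic _ (hd.toDeleteEdges G {s(x, y)} fun e' he' h => by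
        rw [Set.mem_singleton_iff.1 h] at he'; exact hed he')
  refine ⟨hG, {e | e ∈ c.edges}, ⟨u, c, hc, rfl⟩, ?_⟩
  rintro _ ⟨v, d, hd, rfl⟩
  ext e
  exact ⟨key d c hd hc e, key c d hc hd e⟩

theorem girth_eq_length (hG : IsUnicyclic G) {u : V} {c : G.Walk u u} (hc : c.IsCycle) :
    G.girth = c.length := by
  classical
  obtain ⟨v, d, hd, hlen⟩ := exists_girth_eq_length.2 fun h : G.IsAcyclic => h c hc
  have hE : {e | e ∈ d.edges} = {e | e ∈ c.edges} := hG.2.unique ⟨v, d, hd, rfl⟩ ⟨u, c, hc, rfl⟩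
  rw [hlen, ← Walk.length_edges, ← Walk.length_edges,
    ← List.toFinset_card_of_nodup hd.edges_nodup, ← List.toFinset_card_of_nodup hc.edges_nodup]
  congr 1
  ext e
  simpa using Set.ext_iff.1 hE e

theorem exists_isCycle_hexagon {v₀ v₁ v₂ v₃ v₄ v₅ : V} (h₀ : G.Adj v₀ v₁) (h₁ : G.Adj v₁ v₂)
    (h₂ : G.Adj v₂ v₃) (h₃ : G.Adj v₃ v₄) (h₄ : G.Adj v₄ v₅) (h₅ : G.Adj v₅ v₀)
    (h : [v₀, v₁, v₂, v₃, v₄, v₅].Nodup) :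
    ∃ c : G.Walk v₀ v₀, c.IsCycle ∧ c.length = 6 ∧
      ∀ v, v ∈ c.support ↔ v ∈ [v₀, v₁, v₂, v₃, v₄, v₅] := by
  refine ⟨.cons h₀ (.cons h₁ (.cons h₂ (.cons h₃ (.cons h₄ (.cons h₅ .nil))))), ?_, rfl, ?_⟩
  · rw [Walk.cons_isCycle_iff]
    simp only [List.nodup_cons, List.mem_cons, List.not_mem_nil, not_or] at h
    refine ⟨?_, ?_⟩
    · simp [Walk.cons_isPath_iff]
      grind
    · simp
      grind
  · intro v
    simp
    tauto

/-- A table with the local properties of the distance of a graph is its distance. -/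
theorem connected_and_dist_eq [Nonempty V] (D : V → V → ℕ) (h0 : ∀ a, D a a = 0)
    (h1 : ∀ a b c, G.Adj b c → D a b ≤ D a c + 1)
    (h2 : ∀ a b, a ≠ b → ∃ c, G.Adj b c ∧ D a b = D a c + 1) :
    G.Connected ∧ ∀ a b, G.dist a b = D a b := by
  have hw : ∀ a n b, D a b = n → ∃ p : G.Walk b a, p.length = n := by
    intro a n
    induction n with
    | zero =>
      intro b hb
      by_cases hab : a = b
      · subst hab
        exact ⟨.nil, rfl⟩
      · obtain ⟨c, -, hc⟩ := h2 a b hab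
        omega
    | succ n ih =>
      intro b hb
      obtain ⟨c, hbc, hc⟩ := h2 a b (by rintro rfl; rw [h0] at hb; omega)
      obtain ⟨p, hp⟩ := ih c (by omega)
      exact ⟨.cons hbc p, by rw [Walk.length_cons, hp]⟩
  have hG : G.Connected := ⟨fun a b => (hw b _ a rfl).elim fun p _ => ⟨p⟩⟩
  refine ⟨hG, fun a b => le_antisymm ?_ ?_⟩
  · obtain ⟨p, hp⟩ := hw a _ b rfl
    rw [← hp, SimpleGraph.dist_comm]
    exact dist_le p
  · obtain ⟨p, hp⟩ := hG.exists_walk_length_eq_dist b a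
    rw [SimpleGraph.dist_comm, ← hp]
    clear hp
    induction p with
    | nil => rw [h0]; exact Nat.zero_le _
    | @cons b c a hbc p ih =>
      have := h1 a b c hbc
      rw [Walk.length_cons]
      omega

theorem isResolving_pair_iff [DecidableEq V] {x y : V} : IsResolving G {x, y} ↔
    ∀ u v, u ≠ v → G.dist u x ≠ G.dist v x ∨ G.dist u y ≠ G.dist v y := by
  simp [IsResolving]

/-- Singletons are written `{x, x}`, so that one check over ordered pairs covers all candidates with
at most two vertices. -/
theorem exists_eq_pair_of_isResolving [DecidableEq V] [Nontrivial V] {S : Finset V}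
    (hS : IsResolving G S) (hcard : S.card ≤ 2) : ∃ x y, S = {x, y} := by
  obtain ⟨u, v, huv⟩ := exists_pair_ne V
  obtain ⟨x, hx, -⟩ := hS u v huv
  have hpos : 0 < S.card := Finset.card_pos.2 ⟨x, hx⟩
  obtain h | h : S.card = 1 ∨ S.card = 2 := by omega
  · obtain ⟨x, rfl⟩ := Finset.card_eq_one.1 h
    exact ⟨x, x, by simp⟩
  · obtain ⟨x, y, -, rfl⟩ := Finset.card_eq_two.1 h
    exact ⟨x, y, rfl⟩

theorem mem_basisForced_of_pairs [DecidableEq V] [Nontrivial V] {f p q : V}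
    (hpq : IsResolving G {p, q})
    (h : ∀ x y, x ≠ f → y ≠ f → ¬ IsResolving G {x, y}) : f ∈ basisForced G := by
  intro S hS
  obtain ⟨x, y, rfl⟩ := exists_eq_pair_of_isResolving hS.1 ((hS.2 _ hpq).trans Finset.card_le_two)
  by_contra hf
  simp only [Finset.mem_insert, Finset.mem_singleton, not_or] at hf
  exact h x y (Ne.symm hf.1) (Ne.symm hf.2) hS.1

theorem isMetricBasis_pair [DecidableEq V] [Nontrivial V] {p q : V}
    (hpq : IsResolving G {p, q}) (h : ∀ x, ¬ IsResolving G {x, x}) : IsMetricBasis G {p, q} := by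
  refine ⟨hpq, fun T hT => ?_⟩
  by_contra! hlt
  have h2 : T.card ≤ 1 := Nat.le_of_lt_succ (hlt.trans_le Finset.card_le_two)
  obtain ⟨x, y, rfl⟩ := exists_eq_pair_of_isResolving hT (by omega)
  by_cases hxy : x = y
  · subst hxy
    exact h x hT
  · rw [Finset.card_pair hxy] at h2
    omega

/-- The metric bases `{f, p}` and `{f, q}` have only `f` in common. -/
theorem basisForced_eq_singleton_of_pairs [DecidableEq V] [Nontrivial V] {f p q : V}
    (hfp : IsResolving G {f, p}) (hfq : IsResolving G {f, q}) (hpq : p ≠ q)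
    (h1 : ∀ x, ¬ IsResolving G {x, x})
    (h2 : ∀ x y, x ≠ f → y ≠ f → ¬ IsResolving G {x, y}) : basisForced G = {f} := by
  ext v
  refine ⟨fun hv => ?_, ?_⟩
  · have e1 := hv _ (isMetricBasis_pair hfp h1)
    have e2 := hv _ (isMetricBasis_pair hfq h1)
    simp only [Finset.mem_insert, Finset.mem_singleton] at e1 e2
    rcases e1 with e1 | e1
    · exact e1
    · rcases e2 with e2 | e2
      · exact e2
      · exact absurd (e1.symm.trans e2) hpq
  · rintro rfl
    exact mem_basisForced_of_pairs hfp h2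

theorem b_eq_zero_of_degree [Finite V] {C : Set V} (hC : C ⊆ cycleVerts G)
    (h1 : ∀ v, (G.neighborSet v).ncard ≤ 3) (h2 : ∀ v ∉ C, (G.neighborSet v).ncard ≤ 2) :
    b G = 0 := by
  have : {v | IsBranchActive G v} = ∅ := by
    ext v
    simp only [Set.mem_ofPred_eq, Set.mem_empty_iff_false, iff_false]
    rintro ⟨-, u, -, ⟨-, hd⟩ | ⟨hu, hd⟩⟩
    · have := h1 u
      omega
    · have := h2 u fun h => hu (hC h)
      omega
  rw [b, this, Set.ncard_empty]

end Criteria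

/-! ### The three examples -/

/-- The graph on `Fin n` with a given list of edges. -/
def listGraph {n : ℕ} (l : List (Fin n × Fin n)) : SimpleGraph (Fin n) where
  Adj a c := a ≠ c ∧ ((a, c) ∈ l ∨ (c, a) ∈ l)
  symm := ⟨fun _ _ h => ⟨h.1.symm, h.2.symm⟩⟩
  loopless := ⟨fun _ h => h.1 rfl⟩

instance {n : ℕ} (l : List (Fin n × Fin n)) : DecidableRel (listGraph l).Adj :=
  fun a c => inferInstanceAs (Decidable (a ≠ c ∧ ((a, c) ∈ l ∨ (c, a) ∈ l)))

/-- The function given by a table. -/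
def tableFun {n : ℕ} (T : List (List ℕ)) (a c : Fin n) : ℕ := (T.getD a []).getD c 0

/-- A hexagon with attached trees, of the first type. -/
def typeOneGraph : SimpleGraph (Fin 11) := listGraph
  [(0, 1), (1, 2), (2, 3), (3, 4), (4, 5), (5, 0), (0, 6), (2, 7), (3, 8), (4, 9), (5, 10)]

instance : DecidableRel typeOneGraph.Adj := inferInstanceAs (DecidableRel (listGraph _).Adj)

/-- The distances in `typeOneGraph`. -/
def typeOneDist : Fin 11 → Fin 11 → ℕ := tableFun
  [[0, 1, 2, 3, 2, 1, 1, 3, 4, 3, 2],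
   [1, 0, 1, 2, 3, 2, 2, 2, 3, 4, 3],
   [2, 1, 0, 1, 2, 3, 3, 1, 2, 3, 4],
   [3, 2, 1, 0, 1, 2, 4, 2, 1, 2, 3],
   [2, 3, 2, 1, 0, 1, 3, 3, 2, 1, 2],
   [1, 2, 3, 2, 1, 0, 2, 4, 3, 2, 1],
   [1, 2, 3, 4, 3, 2, 0, 4, 5, 4, 3],
   [3, 2, 1, 2, 3, 4, 4, 0, 3, 4, 5],
   [4, 3, 2, 1, 2, 3, 5, 3, 0, 3, 4],
   [3, 4, 3, 2, 1, 2, 4, 4, 3, 0, 3],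
   [2, 3, 4, 3, 2, 1, 3, 5, 4, 3, 0]]

theorem typeOne_connected_and_dist : typeOneGraph.Connected ∧
    ∀ a c, typeOneGraph.dist a c = typeOneDist a c :=
  connected_and_dist_eq typeOneDist (by decide +kernel) (by decide +kernel) (by decide +kernel)

theorem typeOne_card_edgeSet : Nat.card typeOneGraph.edgeSet = Nat.card (Fin 11) := by
  rw [Nat.card_eq_fintype_card, Nat.card_eq_fintype_card]
  decide +kernel

theorem typeOne_exists_isCycle : ∃ c : typeOneGraph.Walk 0 0, c.IsCycle ∧ c.length = 6 ∧
    ∀ v, v ∈ c.support ↔ v ∈ [0, 1, 2, 3, 4, 5] :=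
  exists_isCycle_hexagon (by decide) (by decide) (by decide) (by decide) (by decide) (by decide)
    (by decide)

theorem typeOne_isUnicyclic : IsUnicyclic typeOneGraph := by
  obtain ⟨c, hc, -⟩ := typeOne_exists_isCycle
  exact isUnicyclic_of_card typeOne_connected_and_dist.1 typeOne_card_edgeSet hc

theorem typeOne_girth : 4 ≤ typeOneGraph.girth := by
  obtain ⟨c, hc, hlen, -⟩ := typeOne_exists_isCycle
  rw [girth_eq_length typeOne_isUnicyclic hc, hlen]
  omega

theorem typeOne_isResolving_pair_iff (x y : Fin 11) : IsResolving typeOneGraph {x, y} ↔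
    ∀ u v, u ≠ v → typeOneDist u x ≠ typeOneDist v x ∨ typeOneDist u y ≠ typeOneDist v y := by
  simp only [isResolving_pair_iff, typeOne_connected_and_dist.2]

/-- Two forced vertices suffice: the classification then yields the unique basis and `b = 0`. -/
theorem typeOne_isTypeI : IsTypeI typeOneGraph := by
  have h67 : IsResolving typeOneGraph {6, 7} := by
    rw [typeOne_isResolving_pair_iff]
    decide +kernel
  have h6 : (6 : Fin 11) ∈ basisForced typeOneGraph := by
    refine mem_basisForced_of_pairs h67 ?_
    simp only [typeOne_isResolving_pair_iff]
    decide +kernel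
  have h7 : (7 : Fin 11) ∈ basisForced typeOneGraph := by
    refine mem_basisForced_of_pairs h67 ?_
    simp only [typeOne_isResolving_pair_iff]
    decide +kernel
  have hcard : 1 < (basisForced typeOneGraph).ncard :=
    (Set.one_lt_ncard (Set.toFinite _)).2 ⟨6, h6, 7, h7, by decide⟩
  rcases isType_of_nonempty typeOne_isUnicyclic ⟨6, h6⟩ with h | h | h
  · exact h
  · exact absurd h.2 hcard.ne'
  · exact absurd h.2 hcard.ne'

/-- A hexagon with attached trees, of the second type. -/
def typeTwoGraph : SimpleGraph (Fin 10) := listGraph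
  [(0, 1), (1, 2), (2, 3), (3, 4), (4, 5), (5, 0), (0, 6), (2, 7), (4, 8), (5, 9)]

instance : DecidableRel typeTwoGraph.Adj := inferInstanceAs (DecidableRel (listGraph _).Adj)

/-- The distances in `typeTwoGraph`. -/
def typeTwoDist : Fin 10 → Fin 10 → ℕ := tableFun
  [[0, 1, 2, 3, 2, 1, 1, 3, 3, 2],
   [1, 0, 1, 2, 3, 2, 2, 2, 4, 3],
   [2, 1, 0, 1, 2, 3, 3, 1, 3, 4],
   [3, 2, 1, 0, 1, 2, 4, 2, 2, 3],
   [2, 3, 2, 1, 0, 1, 3, 3, 1, 2],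
   [1, 2, 3, 2, 1, 0, 2, 4, 2, 1],
   [1, 2, 3, 4, 3, 2, 0, 4, 4, 3],
   [3, 2, 1, 2, 3, 4, 4, 0, 4, 5],
   [3, 4, 3, 2, 1, 2, 4, 4, 0, 3],
   [2, 3, 4, 3, 2, 1, 3, 5, 3, 0]]

theorem typeTwo_connected_and_dist : typeTwoGraph.Connected ∧
    ∀ a c, typeTwoGraph.dist a c = typeTwoDist a c :=
  connected_and_dist_eq typeTwoDist (by decide +kernel) (by decide +kernel) (by decide +kernel)

theorem typeTwo_card_edgeSet : Nat.card typeTwoGraph.edgeSet = Nat.card (Fin 10) := by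
  rw [Nat.card_eq_fintype_card, Nat.card_eq_fintype_card]
  decide +kernel

theorem typeTwo_exists_isCycle : ∃ c : typeTwoGraph.Walk 0 0, c.IsCycle ∧ c.length = 6 ∧
    ∀ v, v ∈ c.support ↔ v ∈ [0, 1, 2, 3, 4, 5] :=
  exists_isCycle_hexagon (by decide) (by decide) (by decide) (by decide) (by decide) (by decide)
    (by decide)

theorem typeTwo_isUnicyclic : IsUnicyclic typeTwoGraph := by
  obtain ⟨c, hc, -⟩ := typeTwo_exists_isCycle
  exact isUnicyclic_of_card typeTwo_connected_and_dist.1 typeTwo_card_edgeSet hc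

theorem typeTwo_girth : 4 ≤ typeTwoGraph.girth := by
  obtain ⟨c, hc, hlen, -⟩ := typeTwo_exists_isCycle
  rw [girth_eq_length typeTwo_isUnicyclic hc, hlen]
  omega

theorem typeTwo_isResolving_pair_iff (x y : Fin 10) : IsResolving typeTwoGraph {x, y} ↔
    ∀ u v, u ≠ v → typeTwoDist u x ≠ typeTwoDist v x ∨ typeTwoDist u y ≠ typeTwoDist v y := by
  simp only [isResolving_pair_iff, typeTwo_connected_and_dist.2]

theorem typeTwo_ncard_neighborSet (v : Fin 10) :
    (typeTwoGraph.neighborSet v).ncard = typeTwoGraph.degree v := by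
  rw [Set.ncard_eq_toFinset_card', Set.toFinset_card, card_neighborSet_eq_degree]

/-- One forced vertex is compatible with `b = 0` and `b = 1`, so `b` is computed here from the
degrees. -/
theorem typeTwo_isTypeII : IsTypeII typeTwoGraph := by
  refine ⟨b_eq_zero_of_degree (C := {v | v ∈ [0, 1, 2, 3, 4, 5]}) ?_ ?_ ?_, ?_⟩
  · obtain ⟨c, hc, -, hsupp⟩ := typeTwo_exists_isCycle
    exact fun v hv => ⟨0, c, hc, (hsupp v).2 hv⟩
  · simp only [typeTwo_ncard_neighborSet]
    decide +kernel
  · simp only [typeTwo_ncard_neighborSet, Set.mem_ofPred_eq]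
    decide +kernel
  · rw [basisForced_eq_singleton_of_pairs (f := 7) (p := 6) (q := 8), Set.ncard_singleton]
    · rw [typeTwo_isResolving_pair_iff]
      decide +kernel
    · rw [typeTwo_isResolving_pair_iff]
      decide +kernel
    · decide
    · simp only [typeTwo_isResolving_pair_iff]
      decide +kernel
    · simp only [typeTwo_isResolving_pair_iff]
      decide +kernel

/-- A hexagon with attached trees, of the third type. -/
def typeThreeGraph : SimpleGraph (Fin 12) := listGraph
  [(0, 1), (1, 2), (2, 3), (3, 4), (4, 5), (5, 0), (0, 6), (6, 7), (6, 8), (2, 9), (4, 10), (5, 11)]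

instance : DecidableRel typeThreeGraph.Adj := inferInstanceAs (DecidableRel (listGraph _).Adj)

/-- The distances in `typeThreeGraph`. -/
def typeThreeDist : Fin 12 → Fin 12 → ℕ := tableFun
  [[0, 1, 2, 3, 2, 1, 1, 2, 2, 3, 3, 2],
   [1, 0, 1, 2, 3, 2, 2, 3, 3, 2, 4, 3],
   [2, 1, 0, 1, 2, 3, 3, 4, 4, 1, 3, 4],
   [3, 2, 1, 0, 1, 2, 4, 5, 5, 2, 2, 3],
   [2, 3, 2, 1, 0, 1, 3, 4, 4, 3, 1, 2],
   [1, 2, 3, 2, 1, 0, 2, 3, 3, 4, 2, 1],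
   [1, 2, 3, 4, 3, 2, 0, 1, 1, 4, 4, 3],
   [2, 3, 4, 5, 4, 3, 1, 0, 2, 5, 5, 4],
   [2, 3, 4, 5, 4, 3, 1, 2, 0, 5, 5, 4],
   [3, 2, 1, 2, 3, 4, 4, 5, 5, 0, 4, 5],
   [3, 4, 3, 2, 1, 2, 4, 5, 5, 4, 0, 3],
   [2, 3, 4, 3, 2, 1, 3, 4, 4, 5, 3, 0]]

theorem typeThree_connected_and_dist : typeThreeGraph.Connected ∧
    ∀ a c, typeThreeGraph.dist a c = typeThreeDist a c :=
  connected_and_dist_eq typeThreeDist (by decide +kernel) (by decide +kernel) (by decide +kernel)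

theorem typeThree_card_edgeSet : Nat.card typeThreeGraph.edgeSet = Nat.card (Fin 12) := by
  rw [Nat.card_eq_fintype_card, Nat.card_eq_fintype_card]
  decide +kernel

theorem typeThree_exists_isCycle : ∃ c : typeThreeGraph.Walk 0 0, c.IsCycle ∧ c.length = 6 ∧
    ∀ v, v ∈ c.support ↔ v ∈ [0, 1, 2, 3, 4, 5] :=
  exists_isCycle_hexagon (by decide) (by decide) (by decide) (by decide) (by decide) (by decide)
    (by decide)

theorem typeThree_isUnicyclic : IsUnicyclic typeThreeGraph := by
  obtain ⟨c, hc, -⟩ := typeThree_exists_isCycle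
  exact isUnicyclic_of_card typeThree_connected_and_dist.1 typeThree_card_edgeSet hc

theorem typeThree_girth : 4 ≤ typeThreeGraph.girth := by
  obtain ⟨c, hc, hlen, -⟩ := typeThree_exists_isCycle
  rw [girth_eq_length typeThree_isUnicyclic hc, hlen]
  omega

theorem typeThree_isResolving_pair_iff (x y : Fin 12) : IsResolving typeThreeGraph {x, y} ↔
    ∀ u v, u ≠ v → typeThreeDist u x ≠ typeThreeDist v x ∨ typeThreeDist u y ≠ typeThreeDist v y := by
  simp only [isResolving_pair_iff, typeThree_connected_and_dist.2]

theorem typeThree_isBranchActive : IsBranchActive typeThreeGraph 0 := by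
  obtain ⟨c, hc, -, hsupp⟩ := typeThree_exists_isCycle
  have h6 : (6 : Fin 12) ∉ cycleVerts typeThreeGraph := fun h => by
    have := (hsupp 6).1 (mem_support_of_mem_cycleVerts typeThree_isUnicyclic hc h)
    revert this
    decide
  refine ⟨⟨0, c, hc, c.start_mem_support⟩, 6, Adj.reachable ?_, Or.inr ⟨h6, ?_⟩⟩
  · rw [deleteEdges_adj]
    exact ⟨by decide, fun h => h6 (mem_cycleVerts_of_mem_cycleEdges h).2⟩
  · rw [Set.ncard_eq_toFinset_card', Set.toFinset_card, card_neighborSet_eq_degree]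
    decide +kernel

/-- It is enough to exhibit one branch-active vertex, as the classification bounds `b` by 1. The
leaves `7` and `8` at the branching vertex `6` are interchangeable partners of the forced vertex
`9`. -/
theorem typeThree_isTypeIII : IsTypeIII typeThreeGraph := by
  have h9 : basisForced typeThreeGraph = {9} := by
    refine basisForced_eq_singleton_of_pairs (p := 7) (q := 8) ?_ ?_ (by decide) ?_ ?_
    · rw [typeThree_isResolving_pair_iff]
      decide +kernel
    · rw [typeThree_isResolving_pair_iff]
      decide +kernel
    · simp only [typeThree_isResolving_pair_iff]
      decide +kernel
    · simp only [typeThree_isResolving_pair_iff]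
      decide +kernel
  have hb : b typeThreeGraph ≠ 0 :=
    ((Set.ncard_pos (Set.toFinite _)).2 ⟨0, typeThree_isBranchActive⟩).ne'
  rcases isType_of_nonempty typeThree_isUnicyclic (h9 ▸ Set.singleton_nonempty _) with h | h | h
  · exact absurd h.1 hb
  · exact absurd h.1 hb
  · exact h

end Unicyclic

theorem mainTheorem6 :
    (∀ (V : Type*) [Finite V] (G : SimpleGraph V), Unicyclic.IsUnicyclic G →
      4 ≤ G.girth → (Unicyclic.basisForced G).ncard = 1 → Unicyclic.b G ≤ 1) ∧
    (∀ (V : Type*) [Finite V] (G : SimpleGraph V), Unicyclic.IsUnicyclic G →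
      (Unicyclic.basisForced G).Nonempty →
        Unicyclic.IsTypeI G ∨ Unicyclic.IsTypeII G ∨ Unicyclic.IsTypeIII G) ∧
    (∃ (n : ℕ) (G : SimpleGraph (Fin n)), Unicyclic.IsUnicyclic G ∧ 4 ≤ G.girth ∧
      Unicyclic.IsTypeI G) ∧
    (∃ (n : ℕ) (G : SimpleGraph (Fin n)), Unicyclic.IsUnicyclic G ∧ 4 ≤ G.girth ∧
      Unicyclic.IsTypeII G) ∧
    (∃ (n : ℕ) (G : SimpleGraph (Fin n)), Unicyclic.IsUnicyclic G ∧ 4 ≤ G.girth ∧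
      Unicyclic.IsTypeIII G) := by
  refine ⟨fun V _ G hG _ h1 => ?_, fun V _ G hG => Unicyclic.isType_of_nonempty hG,
    ⟨11, _, Unicyclic.typeOne_isUnicyclic, Unicyclic.typeOne_girth, Unicyclic.typeOne_isTypeI⟩,
    ⟨10, _, Unicyclic.typeTwo_isUnicyclic, Unicyclic.typeTwo_girth, Unicyclic.typeTwo_isTypeII⟩,
    ⟨12, _, Unicyclic.typeThree_isUnicyclic, Unicyclic.typeThree_girth,
      Unicyclic.typeThree_isTypeIII⟩⟩
  rcases Unicyclic.isType_of_nonempty hG (Set.nonempty_of_ncard_ne_zero (by omega)) with h | h | h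
  · rw [h.1]; omega
  · rw [h.1]; omega
  · rw [h.1]
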